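/- Notation. Let $n\ge 3$. A facet $F$ of a polytope $P$ is called special if $P$ has another facet $F'\ne F$ that is parallel to $F$. Two polytopes are affinely equivalent if some affine map between their ambient spaces restricts to a bijection between them. Let $V=\{x\in\mathbb R^{n+1}: x_1+\cdots+x_{n+1}=0\}$, $\alpha_i=e_i-e_{i+1}$ for $1\le i\le n$, and let $\Phi_{\ge -1}=\{e_i-e_j : 1\le i<j\le n+1\}\cup\{-\alpha_1,\dots,-\alpha_n\}$ be the set of almost positive roots of type $A_n$. They correspond bijectively to the diagonals of a convex $(n+3)$-gon with vertices $0,1,\dots,n+2$ in cyclic order: $-\alpha_1,\dots,-\alpha_n$ are the successive diagonals of the snake (the zigzag path with successive vertices $1,n+2,2,n+1,3,n,\dots$), and $\alpha_i+\alpha_{i+1}+\cdots+\alpha_j$ is the unique diagonal that crosses, among the diagonals of the snake, exactly those of $-\alpha_i,\dots,-\alpha_j$. The cluster fan of type $A_n$ consists of the cones $\mathbb R_{\ge 0}S$ generated by the sets $S\subseteq\Phi_{\ge -1}$ whose corresponding diagonals are pairwise non-crossing; its maximal cones are those of the clusters, the maximal such $S$. By $\mathrm{Ass}^{\mathrm{II}}_n(A_n)$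 we mean any polytope in $V$ whose normal fan is the cluster fan of type $A_n$. For positive reals $\mathbf a=(a_{ij})_{1\le i\le j\le n+1}$ let $$\mathrm{Ass}^{\mathrm{III}}_n(\mathbf a)=\sum_{1\le i\le j\le n+1} a_{ij}\,\mathrm{conv}\{e_i,e_{i+1},\dots,e_j\}\subset\mathbb R^{n+1}$$ (Minkowski sum). Theorem. Let $n\ge 3$. For every polytope $P=\mathrm{Ass}^{\mathrm{II}}_n(A_n)$ and every choice of positive parameters $\mathbf a$, the polytopes $P$ and $Q=\mathrm{Ass}^{\mathrm{III}}_n(\mathbf a)$ are not affinely equivalent. Moreover: 1. $P$ and $Q$ both have exactly $2n$ special facets. 2. Exactly two special facets of $Q$ intersect exactly $n-1$ other special facets. 3. If $n>3$, every special facet of $P$ intersects more than $n-1$ other special facets. If $n=3$, exactly one special facet of $P$ intersects exactly $n-1=2$ other special facets. -/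

import Mathlib

open scoped Pointwise RealInnerProductSpace

noncomputable section

/-! ### Polytopes, faces, normal fans, affine equivalence -/

/-- A (convex) polytope: the convex hull of a finite set of points. -/
def IsPolytope {E : Type*} [AddCommGroup E] [Module ℝ E] (P : Set E) : Prop :=
  ∃ s : Set E, s.Finite ∧ P = convexHull ℝ s

/-- Two polytopes, possibly in different ambient spaces, are affinely equivalent if some affine map
between the ambient spaces restricts to a bijection between them. -/
def AffinelyEquivalent {E F : Type*} [AddCommGroup E] [Module ℝ E] [AddCommGroup F] [Module ℝ F]
    (P : Set E) (Q : Set F) : Prop :=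
  ∃ f : E →ᵃ[ℝ] F, Set.BijOn f P Q

/-- A nonempty face of `P`: the set of all points of `P` that maximize some linear function. -/
def IsNonemptyFace {E : Type*} [NormedAddCommGroup E] [NormedSpace ℝ E] (P F : Set E) : Prop :=
  F.Nonempty ∧ IsExposed ℝ P F

/-- A facet of `P`: a nonempty face of dimension `dim P - 1`. -/
def IsFacet {E : Type*} [NormedAddCommGroup E] [NormedSpace ℝ E] (P F : Set E) : Prop :=
  IsNonemptyFace P F ∧
    Module.finrank ℝ (vectorSpan ℝ F) + 1 = Module.finrank ℝ (vectorSpan ℝ P)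

/-- The special facets of `P`: the facets that are parallel to another facet. -/
def specialFacets {E : Type*} [NormedAddCommGroup E] [NormedSpace ℝ E] (P : Set E) : Set (Set E) :=
  {F | IsFacet P F ∧ ∃ F', IsFacet P F' ∧ F' ≠ F ∧ (affineSpan ℝ F).Parallel (affineSpan ℝ F')}

/-- The special facets of `P` other than `F` that intersect `F`. -/
def specialNeighbors {E : Type*} [NormedAddCommGroup E] [NormedSpace ℝ E] (P F : Set E) :
    Set (Set E) :=
  {G | G ∈ specialFacets P ∧ G ≠ F ∧ (F ∩ G).Nonempty}

/-- The (outer) normal cone of `P` at `F`: the vectors `u` such that the linear function `⟪u, ·⟫`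
attains its maximum over `P` at every point of `F`. -/
def normalCone {E : Type*} [NormedAddCommGroup E] [InnerProductSpace ℝ E] (P F : Set E) : Set E :=
  {u | ∀ x ∈ F, ∀ y ∈ P, ⟪u, y⟫ ≤ ⟪u, x⟫}

/-- The normal fan of `P`: the normal cones of all its nonempty faces. -/
def normalFan {E : Type*} [NormedAddCommGroup E] [InnerProductSpace ℝ E] (P : Set E) :
    Set (Set E) :=
  {K | ∃ F, IsNonemptyFace P F ∧ K = normalCone P F}

/-! ### The root system of type `A_n` -/

/-- The space `{x ∈ ℝ^(n+1) : x_1 + ⋯ + x_{n+1} = 0}`, with the inner product of `ℝ^(n+1)`.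
Coordinates are indexed from `0` to `n`. -/
def sumZero (n : ℕ) : Submodule ℝ (EuclideanSpace ℝ (Fin (n + 1))) where
  carrier := {x | ∑ i, x i = 0}
  add_mem' := by
    intro x y hx hy
    simp only [Set.mem_ofPred_eq, PiLp.add_apply, Finset.sum_add_distrib] at *
    rw [hx, hy, add_zero]
  zero_mem' := by simp
  smul_mem' := by
    intro c x hx
    simp only [Set.mem_ofPred_eq, PiLp.smul_apply, smul_eq_mul, ← Finset.mul_sum] at *
    rw [hx, mul_zero]

/-- The vector `e_i - e_j`. -/
def root {n : ℕ} (i j : Fin (n + 1)) : sumZero n :=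
  ⟨EuclideanSpace.single i 1 - EuclideanSpace.single j 1, by
    change ∑ k, (EuclideanSpace.single i (1 : ℝ) - EuclideanSpace.single j (1 : ℝ)) k = 0
    simp [Finset.sum_sub_distrib]⟩

/-- The simple root `e_i - e_{i+1}`. -/
def simpleRoot {n : ℕ} (i : Fin n) : sumZero n :=
  root i.castSucc i.succ

/-- The almost positive roots: the positive roots `e_i - e_j`, `i < j`, and the negatives of the
simple roots. -/
def almostPositiveRoots (n : ℕ) : Set (sumZero n) :=
  {β | ∃ i j, i < j ∧ β = root i j} ∪ {β | ∃ i, β = -simpleRoot i}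

/-! ### Diagonals of the `(n+3)`-gon and the cluster complex of type `A_n` -/

/-- A diagonal of a convex `(n+3)`-gon with vertices labelled `0, 1, …, n+2` in cyclic order:
a pair `lo < hi` of vertices that are not adjacent. -/
structure Diagonal (n : ℕ) where
  lo : ℕ
  hi : ℕ
  hi_le : hi ≤ n + 2
  lo_hi : lo + 2 ≤ hi
  not_edge : ¬ (lo = 0 ∧ hi = n + 2)

/-- Two diagonals cross if they meet in the interior of the polygon at an interior point of both,
that is, if their endpoints are distinct and alternate along the boundary. -/
def Crosses {n : ℕ} (d e : Diagonal n) : Prop :=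
  (d.lo < e.lo ∧ e.lo < d.hi ∧ d.hi < e.hi) ∨ (e.lo < d.lo ∧ d.lo < e.hi ∧ e.hi < d.hi)

/-- The diagonals of the snake, the zigzag path with the successive vertices
`1, n+2, 2, n+1, 3, n, …`. -/
def snake {n : ℕ} (k : Fin n) : Diagonal n where
  lo := ((k : ℕ) + 1) / 2 + 1
  hi := n + 2 - (k : ℕ) / 2
  hi_le := by omega
  lo_hi := by have := k.isLt; omega
  not_edge := by omega

/-- The correspondence between almost positive roots and diagonals. The negative simple roots
correspond to the diagonals of the snake, in order. The positive root `α_i + α_{i+1} + ⋯ + α_j`,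
which is `e_i - e_{j+1}`, corresponds to the diagonal that crosses the diagonals of
`-α_i, -α_{i+1}, …, -α_j` and no other diagonal of the snake. -/
def CorrespondsTo {n : ℕ} (β : sumZero n) (d : Diagonal n) : Prop :=
  (∃ i : Fin n, β = -simpleRoot i ∧ d = snake i) ∨
    ∃ i j : Fin n, i ≤ j ∧ β = root i.castSucc j.succ ∧
      ∀ k : Fin n, Crosses d (snake k) ↔ i ≤ k ∧ k ≤ j

/-- Two almost positive roots are compatible if the corresponding diagonals do not cross. -/
def Compatible {n : ℕ} (β γ : sumZero n) : Prop :=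
  ∃ d e : Diagonal n, CorrespondsTo β d ∧ CorrespondsTo γ e ∧ ¬ Crosses d e

/-- The cluster complex of type `A_n`: its simplices are the sets of pairwise compatible almost
positive roots. -/
def clusterComplex (n : ℕ) : Set (Set (sumZero n)) :=
  {S | S ⊆ almostPositiveRoots n ∧ S.Pairwise Compatible}

/-- The simplicial fan of the cluster complex: the cones generated by its simplices. The maximal
ones are generated by the clusters, the maximal simplices; the others are their faces. -/
def clusterFan (n : ℕ) : Set (Set (sumZero n)) :=
  {K | ∃ S ∈ clusterComplex n, K = (PointedCone.hull ℝ S : Set (sumZero n))}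

/-! ### The two families of associahedra -/

/-- `P` is an associahedron of the second type: a polytope in the space `x_1 + ⋯ + x_{n+1} = 0`
whose normal fan is the cluster fan of type `A_n`. -/
def IsAssII (n : ℕ) (P : Set (sumZero n)) : Prop :=
  IsPolytope P ∧ normalFan P = clusterFan n

/-- The simplex `conv {e_i, e_{i+1}, …, e_j}` in `ℝ^(n+1)`. -/
def intervalSimplex {n : ℕ} (i j : Fin (n + 1)) : Set (EuclideanSpace ℝ (Fin (n + 1))) :=
  convexHull ℝ ((fun k => EuclideanSpace.single k (1 : ℝ)) '' Set.Icc i j)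

/-- The associahedron of the third type: the Minkowski sum of the `a_{ij} Δ_{[i,…,j]}`
over all `i ≤ j`. -/
def AssIII (n : ℕ) (a : Fin (n + 1) → Fin (n + 1) → ℝ) : Set (EuclideanSpace ℝ (Fin (n + 1))) :=
  ∑ i, ∑ j ∈ Finset.Ici i, a i j • intervalSimplex i j

end

/-! The invariant that separates the polytopes is the number of special facets meeting exactly `n -
1` other special facets. It is at least 2 for Q and at most 1 for P. An affine bijection from P to Q
extends an injective map, because P is full-dimensional, and injective affine maps preserve facets,
parallelism and intersections (`specialFacets_image`, `specialNeighbors_image`).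

For P everything is read off the fan. Its facets are the maximal faces in the directions of the
almost positive roots, two of them are parallel exactly when the roots are opposite, and two meet
exactly when the roots lie in a common simplex (`HasSimplicialNormalFan`). So the special facets
belong to the `2n` roots ±α_i, and intersections become crossings of diagonals. The facet of -α_i
misses only that of α_i, giving `2(n - 1)` neighbors. The facets of α_i and α_j with i ≠ j meet
unless |i - j| = 1, so that of α_i has `n - 1` neighbors plus one for every j with |i - j| ≥ 2. No
such j exists, when n ≥ 3, only for n = 3 and the middle root.

For Q, the face in direction u is governed by the sets where u is maximal on each interval. Its
facets correspond to proper intervals I, with outer normal minus the indicator of I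
(`exists_Icc_of_isFacet_AssIII`), and are parallel for complementary intervals, so the special ones
come from initial and final segments. Two initial segments always give intersecting facets, as do
two final ones; an initial and a final one do exactly when a gap separates them. Only [0, n-1] and
[1, n] leave room for no gap, hence the count 2. -/

/-! ### Maximal faces, and facets via functionals constant on them -/

section Faces

variable {E : Type*} [NormedAddCommGroup E] [InnerProductSpace ℝ E]

/-- The face of `P` on which the linear function `⟪u, ·⟫` attains its maximum over `P`. -/
def maxFace (P : Set E) (u : E) : Set E := {x ∈ P | ∀ y ∈ P, ⟪u, y⟫ ≤ ⟪u, x⟫}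

lemma maxFace_subset (P : Set E) (u : E) : maxFace P u ⊆ P := fun _ h => h.1

lemma isNonemptyFace_iff [CompleteSpace E] {P F : Set E} :
    IsNonemptyFace P F ↔ F.Nonempty ∧ ∃ u, F = maxFace P u := by
  constructor
  · rintro ⟨hne, h⟩
    obtain ⟨l, hl⟩ := h hne
    refine ⟨hne, (InnerProductSpace.toDual ℝ E).symm l, ?_⟩
    rw [hl]
    simp [maxFace]
  · rintro ⟨hne, u, rfl⟩
    refine ⟨hne, fun _ => ⟨InnerProductSpace.toDual ℝ E u, ?_⟩⟩
    simp [maxFace]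

lemma maxFace_zero (P : Set E) : maxFace P 0 = P := by simp [maxFace]

lemma inner_eq_of_mem_maxFace {P : Set E} {u x y : E} (hx : x ∈ maxFace P u)
    (hy : y ∈ maxFace P u) : ⟪u, x⟫ = ⟪u, y⟫ :=
  le_antisymm (hy.2 x hx.1) (hx.2 y hy.1)

lemma maxFace_smul (P : Set E) (u : E) {c : ℝ} (hc : 0 < c) : maxFace P (c • u) = maxFace P u := by
  ext x
  simp only [maxFace, real_inner_smul_left, Set.mem_ofPred_eq, mul_le_mul_iff_right₀ hc]

lemma mem_orthogonal_vectorSpan {F : Set E} {w : E} :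
    w ∈ (vectorSpan ℝ F)ᗮ ↔ ∀ x ∈ F, ∀ y ∈ F, ⟪w, x⟫ = ⟪w, y⟫ := by
  rw [Submodule.mem_orthogonal', vectorSpan_def]
  constructor
  · intro h x hx y hy
    have := h (x - y) (Submodule.subset_span ⟨x, hx, y, hy, rfl⟩)
    rw [inner_sub_right] at this
    linarith
  · intro h v hv
    induction hv using Submodule.span_induction with
    | mem v hv =>
      obtain ⟨x, hx, y, hy, rfl⟩ := hv
      simp [inner_sub_right, h x hx y hy]
    | zero => simp
    | add v v' _ _ h1 h2 => rw [inner_add_right, h1, h2, add_zero]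
    | smul c v _ h1 => rw [inner_smul_right, h1, mul_zero]

lemma mem_orthogonal_vectorSpan_maxFace (P : Set E) (u : E) :
    u ∈ (vectorSpan ℝ (maxFace P u))ᗮ :=
  mem_orthogonal_vectorSpan.2 fun _ hx _ hy => inner_eq_of_mem_maxFace hx hy

/-- For both families the functionals constant on a face are easy to determine, so dimensions are
measured through orthogonal complements. -/
lemma isFacet_iff_finrank_orthogonal [FiniteDimensional ℝ E] {P F : Set E} :
    IsFacet P F ↔ (F.Nonempty ∧ ∃ u, F = maxFace P u) ∧
      Module.finrank ℝ (vectorSpan ℝ F)ᗮ = Module.finrank ℝ (vectorSpan ℝ P)ᗮ + 1 := by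
  rw [IsFacet, isNonemptyFace_iff]
  have h1 := (vectorSpan ℝ F).finrank_add_finrank_orthogonal
  have h2 := (vectorSpan ℝ P).finrank_add_finrank_orthogonal
  refine and_congr_right fun _ => ?_
  omega

lemma parallel_iff_orthogonal_eq [FiniteDimensional ℝ E] {F G : Set E} (hF : F.Nonempty)
    (hG : G.Nonempty) : (affineSpan ℝ F).Parallel (affineSpan ℝ G) ↔
      (vectorSpan ℝ F)ᗮ = (vectorSpan ℝ G)ᗮ := by
  rw [AffineSubspace.affineSpan_parallel_iff_vectorSpan_eq_and_eq_empty_iff_eq_empty]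
  simp only [hF.ne_empty, hG.ne_empty, and_true]
  constructor
  · intro h; rw [h]
  · intro h
    rw [← (vectorSpan ℝ F).orthogonal_orthogonal, h, Submodule.orthogonal_orthogonal]

end Faces

/-! ### Counting special facets and neighbors through an indexing -/

section Counting

variable {E : Type*} [NormedAddCommGroup E] [NormedSpace ℝ E] {ι : Type*}

lemma specialNeighbors_eq_image {P : Set E} {G : ι → Set E}
    (hG : Function.Injective G) (hP : specialFacets P = Set.range G) (i : ι) :
    specialNeighbors P (G i) = G '' {j | j ≠ i ∧ (G i ∩ G j).Nonempty} := by
  ext F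
  simp only [specialNeighbors, hP, Set.mem_ofPred_eq, Set.mem_image]
  constructor
  · rintro ⟨⟨j, rfl⟩, hne, hint⟩
    exact ⟨j, ⟨fun h => hne (by rw [h]), hint⟩, rfl⟩
  · rintro ⟨j, ⟨hne, hint⟩, rfl⟩
    exact ⟨⟨j, rfl⟩, fun h => hne (hG h), hint⟩

lemma ncard_specialNeighbors {P : Set E} {G : ι → Set E}
    (hG : Function.Injective G) (hP : specialFacets P = Set.range G) (i : ι) :
    (specialNeighbors P (G i)).ncard = {j | j ≠ i ∧ (G i ∩ G j).Nonempty}.ncard := by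
  rw [specialNeighbors_eq_image hG hP, Set.ncard_image_of_injective _ hG]

lemma ncard_specialFacets {P : Set E} {G : ι → Set E}
    (hG : Function.Injective G) (hP : specialFacets P = Set.range G) :
    (specialFacets P).ncard = Nat.card ι := by
  rw [hP, ← Set.image_univ, Set.ncard_image_of_injective _ hG, Set.ncard_univ]

lemma ncard_set_prod_bool {α : Type*} [Finite α] (s : Set (α × Bool)) :
    s.ncard = {a | (a, true) ∈ s}.ncard + {a | (a, false) ∈ s}.ncard := by
  have h : s = (fun a => (a, true)) '' {a | (a, true) ∈ s} ∪
      (fun a => (a, false)) '' {a | (a, false) ∈ s} := by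
    ext ⟨a, b⟩
    cases b <;> simp
  conv_lhs => rw [h]
  rw [Set.ncard_union_eq, Set.ncard_image_of_injective, Set.ncard_image_of_injective]
  · intro a b h; simpa using h
  · intro a b h; simpa using h
  · rw [Set.disjoint_left]
    rintro _ ⟨a, _, rfl⟩ ⟨b, _, h⟩
    simp at h

lemma ncard_ne {n : ℕ} (i : Fin n) : {j : Fin n | j ≠ i}.ncard = n - 1 := by
  have h : {j : Fin n | j ≠ i} = {i}ᶜ := by ext; simp
  rw [h, Set.ncard_compl]
  simp

end Counting

/-! ### Invariance under injective affine maps -/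

section AffineInvariance

variable {E F : Type*} [NormedAddCommGroup E] [NormedSpace ℝ E] [FiniteDimensional ℝ E]
  [NormedAddCommGroup F] [NormedSpace ℝ F] [FiniteDimensional ℝ F]

/-- Exposing functionals pull back along the linear part of `f` and push forward along a left
inverse of it; the constant `f 0` does not affect comparisons. -/
lemma isExposed_image_iff {f : E →ᵃ[ℝ] F} (hf : Function.Injective f) {P A : Set E} :
    IsExposed ℝ (f '' P) (f '' A) ↔ IsExposed ℝ P A := by
  have hdec : ∀ x, f x = f.linear x + f 0 := fun x => by
    have := f.map_vadd 0 x
    simpa using this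
  have key : ∀ (l : StrongDual ℝ E) (l' : StrongDual ℝ F),
      (∀ x y, l y ≤ l x ↔ l' (f y) ≤ l' (f x)) →
      (f '' A = {x ∈ f '' P | ∀ y ∈ f '' P, l' y ≤ l' x} ↔ A = {x ∈ P | ∀ y ∈ P, l y ≤ l x}) := by
    intro l l' h
    have : {x ∈ f '' P | ∀ y ∈ f '' P, l' y ≤ l' x} = f '' {x ∈ P | ∀ y ∈ P, l y ≤ l x} := by
      ext z
      simp only [Set.mem_ofPred_eq, Set.forall_mem_image]
      simp only [Set.mem_image]
      constructor
      · rintro ⟨⟨x, hx, rfl⟩, hz⟩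
        exact ⟨x, ⟨hx, fun y hy => (h x y).2 (hz hy)⟩, rfl⟩
      · rintro ⟨x, ⟨hx, hz⟩, rfl⟩
        exact ⟨⟨x, hx, rfl⟩, fun y hy => (h x y).1 (hz y hy)⟩
    rw [this, hf.image_injective.eq_iff]
  constructor
  · intro h hne
    obtain ⟨l', hl'⟩ := h (hne.image f)
    refine ⟨l'.comp (LinearMap.toContinuousLinearMap f.linear), (key _ l' fun x y => ?_).1 hl'⟩
    rw [hdec x, hdec y]
    simp
  · intro h hne
    obtain ⟨l, hl⟩ := h hne.of_image
    obtain ⟨g, hg⟩ := f.linear.exists_leftInverse_of_injective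
      (LinearMap.ker_eq_bot.2 (f.linear_injective_iff.2 hf))
    have hg' : ∀ x, g (f.linear x) = x := fun x => by
      rw [← LinearMap.comp_apply, hg, LinearMap.id_apply]
    refine ⟨l.comp (LinearMap.toContinuousLinearMap g), (key l _ fun x y => ?_).2 hl⟩
    rw [hdec x, hdec y]
    simp [hg']

omit [FiniteDimensional ℝ E] [FiniteDimensional ℝ F] in
lemma finrank_vectorSpan_image {f : E →ᵃ[ℝ] F} (hf : Function.Injective f) (A : Set E) :
    Module.finrank ℝ (vectorSpan ℝ (f '' A)) = Module.finrank ℝ (vectorSpan ℝ A) := by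
  rw [← AffineMap.map_vectorSpan]
  exact (Submodule.equivMapOfInjective _ (f.linear_injective_iff.2 hf) _).finrank_eq.symm

lemma isFacet_image_iff {f : E →ᵃ[ℝ] F} (hf : Function.Injective f) {P A : Set E} :
    IsFacet (f '' P) (f '' A) ↔ IsFacet P A := by
  simp only [IsFacet, IsNonemptyFace, isExposed_image_iff hf, finrank_vectorSpan_image hf,
    Set.image_nonempty]

omit [FiniteDimensional ℝ E] [FiniteDimensional ℝ F] in
lemma IsFacet.exists_eq_image {f : E →ᵃ[ℝ] F} {P : Set E} {B : Set F} (h : IsFacet (f '' P) B) :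
    ∃ A, B = f '' A := by
  obtain ⟨A, -, hA⟩ := Set.subset_image_iff.1 h.1.2.subset
  exact ⟨A, hA.symm⟩

omit [FiniteDimensional ℝ E] [FiniteDimensional ℝ F] in
lemma parallel_image_iff {f : E →ᵃ[ℝ] F} (hf : Function.Injective f) {A B : Set E} :
    (affineSpan ℝ (f '' A)).Parallel (affineSpan ℝ (f '' B)) ↔
      (affineSpan ℝ A).Parallel (affineSpan ℝ B) := by
  simp only [AffineSubspace.affineSpan_parallel_iff_vectorSpan_eq_and_eq_empty_iff_eq_empty,
    ← AffineMap.map_vectorSpan, Set.image_eq_empty,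
    (Submodule.map_injective_of_injective (f.linear_injective_iff.2 hf)).eq_iff]

lemma specialFacets_image {f : E →ᵃ[ℝ] F} (hf : Function.Injective f) (P : Set E) :
    specialFacets (f '' P) = Set.image f '' specialFacets P := by
  ext B
  simp only [specialFacets, Set.mem_ofPred_eq, Set.mem_image]
  constructor
  · rintro ⟨hB, B', hB', hne, hpar⟩
    obtain ⟨A, rfl⟩ := hB.exists_eq_image
    obtain ⟨A', rfl⟩ := hB'.exists_eq_image
    exact ⟨A, ⟨(isFacet_image_iff hf).1 hB, A', (isFacet_image_iff hf).1 hB',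
      fun h => hne (by rw [h]), (parallel_image_iff hf).1 hpar⟩, rfl⟩
  · rintro ⟨A, ⟨hA, A', hA', hne, hpar⟩, rfl⟩
    exact ⟨(isFacet_image_iff hf).2 hA, f '' A', (isFacet_image_iff hf).2 hA',
      fun h => hne (hf.image_injective h), (parallel_image_iff hf).2 hpar⟩

lemma specialNeighbors_image {f : E →ᵃ[ℝ] F} (hf : Function.Injective f) (P A : Set E) :
    specialNeighbors (f '' P) (f '' A) = Set.image f '' specialNeighbors P A := by
  ext B
  simp only [specialNeighbors, specialFacets_image hf, Set.mem_ofPred_eq, Set.mem_image]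
  constructor
  · rintro ⟨⟨A', hA', rfl⟩, hne, hint⟩
    rw [← Set.image_inter hf, Set.image_nonempty] at hint
    exact ⟨A', ⟨hA', fun h => hne (by rw [h]), hint⟩, rfl⟩
  · rintro ⟨A', ⟨hA', hne, hint⟩, rfl⟩
    rw [← Set.image_inter hf, Set.image_nonempty]
    exact ⟨⟨A', hA', rfl⟩, fun h => hne (hf.image_injective h), hint⟩

lemma ncard_specialFacets_with_ncard_specialNeighbors_image {f : E →ᵃ[ℝ] F}
    (hf : Function.Injective f) (P : Set E) (m : ℕ) :
    {B ∈ specialFacets (f '' P) | (specialNeighbors (f '' P) B).ncard = m}.ncard =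
      {A ∈ specialFacets P | (specialNeighbors P A).ncard = m}.ncard := by
  have h : {B ∈ specialFacets (f '' P) | (specialNeighbors (f '' P) B).ncard = m} =
      Set.image f '' {A ∈ specialFacets P | (specialNeighbors P A).ncard = m} := by
    ext B
    simp only [specialFacets_image hf, Set.mem_ofPred_eq, Set.mem_image]
    constructor
    · rintro ⟨⟨A, hA, rfl⟩, hm⟩
      rw [specialNeighbors_image hf, Set.ncard_image_of_injective _ hf.image_injective] at hm
      exact ⟨A, ⟨hA, hm⟩, rfl⟩
    · rintro ⟨A, ⟨hA, hm⟩, rfl⟩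
      refine ⟨⟨A, hA, rfl⟩, ?_⟩
      rwa [specialNeighbors_image hf, Set.ncard_image_of_injective _ hf.image_injective]
  rw [h, Set.ncard_image_of_injective _ hf.image_injective]

omit [FiniteDimensional ℝ F] in
-- Affine equivalence only asks for bijectivity on `P`. Since `P` has an interior point `p`, a
-- direction killed by the linear part would identify `p` with a nearby point of `P`.
lemma injective_of_injOn_of_vectorSpan_eq_top {f : E →ᵃ[ℝ] F} {P : Set E} (hf : Set.InjOn f P)
    (hconv : Convex ℝ P) (hP : vectorSpan ℝ P = ⊤) (hne : P.Nonempty) : Function.Injective f := by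
  have htop : affineSpan ℝ P = ⊤ :=
    (AffineSubspace.affineSpan_eq_top_iff_vectorSpan_eq_top_of_nonempty _ _ _ hne).2 hP
  obtain ⟨p, hp⟩ := hconv.interior_nonempty_iff_affineSpan_eq_top.2 htop
  rw [← f.linear_injective_iff, injective_iff_map_eq_zero]
  intro v hv
  have hcont : Continuous fun t : ℝ => t • v + p := by fun_prop
  have hev : ∀ᶠ t in nhds (0 : ℝ), t • v + p ∈ P :=
    hcont.continuousAt.eventually (by simpa using mem_interior_iff_mem_nhds.1 hp)
  obtain ⟨t, htP, ht0⟩ := ((hev.filter_mono nhdsWithin_le_nhds).and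
    (self_mem_nhdsWithin (s := {0}ᶜ))).exists
  have h : f (t • v + p) = f p := by
    have := f.map_vadd p (t • v)
    simpa [hv] using this
  have h' := hf htP (interior_subset hp) h
  rw [add_eq_right] at h'
  exact (smul_eq_zero.1 h').resolve_left ht0

end AffineInvariance

/-! ### Normal cones of polytopes -/

section NormalFan

variable {E : Type*} [NormedAddCommGroup E] [InnerProductSpace ℝ E]

lemma maxFace_subset_of_mem_normalCone {P : Set E} {u v : E}
    (h : v ∈ normalCone P (maxFace P u)) : maxFace P u ⊆ maxFace P v :=
  fun x hx => ⟨hx.1, fun y hy => h x hx y hy⟩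

lemma mem_normalCone_maxFace (P : Set E) (u : E) : u ∈ normalCone P (maxFace P u) :=
  fun _ hx y hy => hx.2 y hy

lemma smul_mem_normalCone {P F : Set E} {u : E} (h : u ∈ normalCone P F) {c : ℝ} (hc : 0 ≤ c) :
    c • u ∈ normalCone P F := by
  intro x hx y hy
  rw [real_inner_smul_left, real_inner_smul_left]
  exact mul_le_mul_of_nonneg_left (h x hx y hy) hc

lemma normalCone_subset_orthogonal {P F : Set E} (hF : F ⊆ P) :
    normalCone P F ⊆ (vectorSpan ℝ F)ᗮ := fun _ hw =>
  mem_orthogonal_vectorSpan.2 fun x hx y hy =>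
    le_antisymm (hw y hy x (hF hx)) (hw x hx y (hF hy))

lemma orthogonal_subset_normalCone {P F : Set E} (hF : F ⊆ P) :
    ((vectorSpan ℝ P)ᗮ : Set E) ⊆ normalCone P F := fun _ hw x hx y hy =>
  (mem_orthogonal_vectorSpan.1 hw y hy x (hF hx)).le

/-- The normal cone of a face is a face of the normal cone of any smaller nonempty set. -/
lemma mem_normalCone_of_add_mem {P F H : Set E} (hF : F ⊆ P) (hHF : H ⊆ F) (hH : H.Nonempty)
    {u v : E} (hu : u ∈ normalCone P H) (hv : v ∈ normalCone P H)
    (huv : u + v ∈ normalCone P F) : u ∈ normalCone P F := by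
  obtain ⟨x, hx⟩ := hH
  intro z hz y hy
  have h1 := huv z hz x (hF (hHF hx))
  have h2 := hv x hx z (hF hz)
  have h3 := hu x hx y hy
  rw [inner_add_left, inner_add_left] at h1
  linarith

/-- Every linear function constant on a face of a polytope is a perturbation of a normal vector
of the face. -/
lemma exists_add_smul_mem_normalCone {P : Set E} (hP : IsPolytope P) {u w : E}
    (hw : w ∈ (vectorSpan ℝ (maxFace P u))ᗮ) :
    ∃ ε : ℝ, 0 < ε ∧ u + ε • w ∈ normalCone P (maxFace P u) := by
  obtain ⟨s, hs, rfl⟩ := hP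
  rcases (maxFace (convexHull ℝ s) u).eq_empty_or_nonempty with hne | ⟨x₀, hx₀⟩
  · exact ⟨1, one_pos, by rw [hne]; simp [normalCone]⟩
  -- Finitely many generators suffice: a strict inequality at `y` survives a small perturbation, and
  -- a tie puts `y` in the face, where `w` is constant.
  have hev : ∀ y ∈ s, ∀ᶠ ε in nhdsWithin (0 : ℝ) (Set.Ioi 0),
      ⟪u + ε • w, y⟫ ≤ ⟪u + ε • w, x₀⟫ := by
    intro y hy
    have hyP := subset_convexHull ℝ s hy
    rcases (hx₀.2 y hyP).lt_or_eq with hlt | heq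
    · have hc : Continuous fun ε : ℝ => ⟪u + ε • w, x₀⟫ - ⟪u + ε • w, y⟫ := by fun_prop
      have := (hc.continuousAt (x := 0)).eventually (lt_mem_nhds (a := 0) (by simpa using hlt))
      filter_upwards [this.filter_mono nhdsWithin_le_nhds] with ε hε
      linarith
    · have hyF : y ∈ maxFace (convexHull ℝ s) u := ⟨hyP, fun z hz => by
        rw [heq]; exact hx₀.2 z hz⟩
      have h := mem_orthogonal_vectorSpan.1 hw y hyF x₀ hx₀
      refine Filter.Eventually.of_forall fun ε => ?_
      rw [inner_add_left, inner_add_left, real_inner_smul_left, real_inner_smul_left, h, heq]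
  obtain ⟨ε, hε, hpos⟩ := (((Filter.eventually_all_finite hs).2 hev).and
    self_mem_nhdsWithin).exists
  refine ⟨ε, hpos, fun x hx y hy => ?_⟩
  have hx' : ⟪u + ε • w, x⟫ = ⟪u + ε • w, x₀⟫ := by
    rw [inner_add_left, inner_add_left, real_inner_smul_left, real_inner_smul_left,
      mem_orthogonal_vectorSpan.1 hw x hx x₀ hx₀, inner_eq_of_mem_maxFace hx hx₀]
  rw [hx']
  have hconv : Convex ℝ {z | ⟪u + ε • w, z⟫ ≤ ⟪u + ε • w, x₀⟫} :=
    convex_halfSpace_le (IsLinearMap.mk (inner_add_right _) fun c z => inner_smul_right _ _ _) _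
  exact convexHull_min hε hconv hy

end NormalFan

/-! ### Reading facets and their intersections off a simplicial fan -/

section SimplicialNormalFan

variable {E : Type*} [NormedAddCommGroup E] [InnerProductSpace ℝ E]

/-- `P` is a polytope whose normal fan consists of the cones over the simplices of a complex `C` on
a set `Φ` of pairwise nonproportional vectors. -/
structure HasSimplicialNormalFan (P : Set E) (Φ : Set E) (C : Set (Set E)) : Prop where
  isPolytope : IsPolytope P
  normalFan_eq : normalFan P = {K | ∃ S ∈ C, K = (PointedCone.hull ℝ S : Set E)}
  empty_mem : ∅ ∈ C
  singleton_mem : ∀ β ∈ Φ, {β} ∈ C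
  subset : ∀ S ∈ C, S ⊆ Φ
  ne_zero : ∀ β ∈ Φ, β ≠ 0
  eq_of_smul : ∀ β ∈ Φ, ∀ γ ∈ Φ, ∀ c : ℝ, 0 < c → γ = c • β → γ = β

lemma mem_hull_singleton {β x : E} :
    x ∈ PointedCone.hull ℝ {β} ↔ ∃ c : ℝ, 0 ≤ c ∧ c • β = x := by
  rw [PointedCone.hull, Submodule.mem_span_singleton]
  exact ⟨fun ⟨c, hc⟩ => ⟨c, c.2, hc⟩, fun ⟨c, h, hc⟩ => ⟨⟨c, h⟩, hc⟩⟩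

namespace HasSimplicialNormalFan

variable [FiniteDimensional ℝ E] {P Φ : Set E} {C : Set (Set E)}
  (h : HasSimplicialNormalFan P Φ C)

include h

lemma exists_simplex {u : E} (hne : (maxFace P u).Nonempty) :
    ∃ S ∈ C, normalCone P (maxFace P u) = (PointedCone.hull ℝ S : Set E) := by
  have : normalCone P (maxFace P u) ∈ normalFan P :=
    ⟨_, isNonemptyFace_iff.2 ⟨hne, u, rfl⟩, rfl⟩
  rwa [h.normalFan_eq] at this

lemma exists_maxFace {S : Set E} (hS : S ∈ C) :
    ∃ u, (maxFace P u).Nonempty ∧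
      normalCone P (maxFace P u) = (PointedCone.hull ℝ S : Set E) := by
  have : (PointedCone.hull ℝ S : Set E) ∈ normalFan P := by
    rw [h.normalFan_eq]; exact ⟨S, hS, rfl⟩
  obtain ⟨F, hF, hK⟩ := this
  obtain ⟨hne, u, rfl⟩ := isNonemptyFace_iff.1 hF
  exact ⟨u, hne, hK.symm⟩

lemma nonempty : P.Nonempty := by
  obtain ⟨u, hne, -⟩ := h.exists_maxFace h.empty_mem
  exact hne.mono (maxFace_subset _ _)

/-- The empty simplex makes {0} a normal cone, while every normal cone contains the functionals
constant on `P`. -/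
lemma orthogonal_eq_bot : (vectorSpan ℝ P)ᗮ = ⊥ := by
  obtain ⟨u, -, hu⟩ := h.exists_maxFace h.empty_mem
  rw [Submodule.eq_bot_iff]
  intro w hw
  have := orthogonal_subset_normalCone (maxFace_subset P u) hw
  rw [hu] at this
  simpa using this

lemma vectorSpan_eq_top : vectorSpan ℝ P = ⊤ :=
  (Submodule.orthogonal_eq_bot_iff).1 h.orthogonal_eq_bot

lemma maxFace_ne {u : E} (hu : u ≠ 0) : maxFace P u ≠ P := by
  intro heq
  have := mem_orthogonal_vectorSpan_maxFace P u
  rw [heq, h.orthogonal_eq_bot] at this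
  exact hu (by simpa using this)

/-- The ray of `β` is the normal cone of some face, whose defining functional lies on that ray. It
is therefore a positive multiple of `β`, defining the same face, or zero; in the latter case `β`
would be constant on `P`. -/
lemma maxFace_nonempty_and_normalCone {β : E} (hβ : β ∈ Φ) :
    (maxFace P β).Nonempty ∧
      normalCone P (maxFace P β) = (PointedCone.hull ℝ {β} : Set E) := by
  obtain ⟨u, hne, hu⟩ := h.exists_maxFace (h.singleton_mem β hβ)
  have hmem := mem_normalCone_maxFace P u
  rw [hu, SetLike.mem_coe, mem_hull_singleton] at hmem
  obtain ⟨c, hc, rfl⟩ := hmem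
  rcases hc.lt_or_eq with hc | rfl
  · rw [maxFace_smul _ _ hc] at hne hu
    exact ⟨hne, hu⟩
  · exfalso
    rw [zero_smul, maxFace_zero] at hu
    have : β ∈ normalCone P P := by
      rw [hu]; exact PointedCone.subset_hull rfl
    have := normalCone_subset_orthogonal subset_rfl this
    rw [h.orthogonal_eq_bot] at this
    exact h.ne_zero β hβ (by simpa using this)

lemma maxFace_nonempty {β : E} (hβ : β ∈ Φ) : (maxFace P β).Nonempty :=
  (h.maxFace_nonempty_and_normalCone hβ).1

lemma mem_normalCone_maxFace_iff {β : E} (hβ : β ∈ Φ) {x : E} :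
    x ∈ normalCone P (maxFace P β) ↔ ∃ c : ℝ, 0 ≤ c ∧ c • β = x := by
  rw [(h.maxFace_nonempty_and_normalCone hβ).2, SetLike.mem_coe, mem_hull_singleton]

lemma orthogonal_vectorSpan_maxFace {β : E} (hβ : β ∈ Φ) :
    (vectorSpan ℝ (maxFace P β))ᗮ = Submodule.span ℝ {β} := by
  apply le_antisymm
  · intro w hw
    obtain ⟨ε, hε, hmem⟩ := exists_add_smul_mem_normalCone h.isPolytope hw
    obtain ⟨c, -, hc⟩ := (h.mem_normalCone_maxFace_iff hβ).1 hmem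
    rw [Submodule.mem_span_singleton]
    refine ⟨ε⁻¹ * (c - 1), ?_⟩
    rw [mul_smul, sub_smul, hc, one_smul, add_sub_cancel_left, smul_smul, inv_mul_cancel₀ hε.ne',
      one_smul]
  · rw [Submodule.span_singleton_le_iff_mem]
    exact mem_orthogonal_vectorSpan_maxFace P β

lemma isFacet_maxFace {β : E} (hβ : β ∈ Φ) : IsFacet P (maxFace P β) := by
  rw [isFacet_iff_finrank_orthogonal]
  refine ⟨⟨h.maxFace_nonempty hβ, β, rfl⟩, ?_⟩
  rw [h.orthogonal_vectorSpan_maxFace hβ, h.orthogonal_eq_bot,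
    finrank_span_singleton (h.ne_zero β hβ), finrank_bot]

/-- For a facet in direction `u`, the functionals constant on it form the line through `u`. Its
simplex is nonempty, since its cone contains `u ≠ 0`, so any vertex is a multiple of `u`. A negative
multiple would make `u` constant on `P`. -/
lemma isFacet_iff {F : Set E} : IsFacet P F ↔ ∃ β ∈ Φ, F = maxFace P β := by
  constructor
  · intro hF
    obtain ⟨⟨hne, u, rfl⟩, hrank⟩ := isFacet_iff_finrank_orthogonal.1 hF
    rw [h.orthogonal_eq_bot, finrank_bot, zero_add] at hrank
    have hu : u ≠ 0 := by
      rintro rfl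
      rw [maxFace_zero, h.orthogonal_eq_bot, finrank_bot] at hrank
      exact zero_ne_one hrank
    have hspan : ∀ w ∈ (vectorSpan ℝ (maxFace P u))ᗮ, ∃ c : ℝ, c • u = w := by
      intro w hw
      have hu' : (⟨u, mem_orthogonal_vectorSpan_maxFace P u⟩ :
          ((vectorSpan ℝ (maxFace P u))ᗮ : Submodule ℝ E)) ≠ 0 := by
        simpa [Subtype.ext_iff] using hu
      obtain ⟨c, hc⟩ := (finrank_eq_one_iff_of_nonzero' _ hu').1 hrank ⟨w, hw⟩
      exact ⟨c, by simpa [Subtype.ext_iff] using hc⟩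
    obtain ⟨S, hS, hcone⟩ := h.exists_simplex hne
    have hSne : S.Nonempty := by
      by_contra hemp
      rw [Set.not_nonempty_iff_eq_empty] at hemp
      subst hemp
      have := mem_normalCone_maxFace P u
      rw [hcone] at this
      exact hu (by simpa using this)
    obtain ⟨β, hβS⟩ := hSne
    have hβ := h.subset S hS hβS
    have hβN : β ∈ normalCone P (maxFace P u) := by
      rw [hcone]; exact PointedCone.subset_hull hβS
    obtain ⟨c, rfl⟩ := hspan β (normalCone_subset_orthogonal (maxFace_subset _ _) hβN)
    refine ⟨_, hβ, ?_⟩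
    have hc0 : c ≠ 0 := by
      rintro rfl
      exact h.ne_zero _ hβ (zero_smul _ _)
    rcases lt_or_gt_of_ne hc0 with hc | hc
    · exfalso
      have hneg : -u ∈ normalCone P (maxFace P u) := by
        have := smul_mem_normalCone hβN (c := -c⁻¹) (by
          rw [neg_nonneg]; exact (inv_lt_zero.2 hc).le)
        rwa [smul_smul, neg_mul, inv_mul_cancel₀ hc0, neg_one_smul] at this
      apply h.maxFace_ne hu
      refine (maxFace_subset _ _).antisymm fun x hx => ?_
      obtain ⟨x₀, hx₀⟩ := hne
      refine ⟨hx, fun y hy => (hx₀.2 y hy).trans ?_⟩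
      have := hneg x₀ hx₀ x hx
      rw [inner_neg_left, inner_neg_left] at this
      linarith
    · rw [maxFace_smul _ _ hc]
  · rintro ⟨β, hβ, rfl⟩
    exact h.isFacet_maxFace hβ

lemma eq_of_maxFace_eq {β γ : E} (hβ : β ∈ Φ) (hγ : γ ∈ Φ) (heq : maxFace P β = maxFace P γ) :
    β = γ := by
  have hmem := mem_normalCone_maxFace P β
  rw [heq, h.mem_normalCone_maxFace_iff hγ] at hmem
  obtain ⟨c, hc, hcβ⟩ := hmem
  rcases hc.lt_or_eq with hc | rfl
  · exact h.eq_of_smul γ hγ β hβ c hc hcβ.symm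
  · exact absurd (by rw [← hcβ, zero_smul]) (h.ne_zero β hβ)

/-- A ray of the fan that lies in the cone over a simplex is spanned by a vertex of it. -/
lemma mem_of_subset_maxFace {β u : E} (hβ : β ∈ Φ) (hne : (maxFace P u).Nonempty)
    (hsub : maxFace P u ⊆ maxFace P β) {S : Set E} (hS : S ∈ C)
    (hcone : normalCone P (maxFace P u) = (PointedCone.hull ℝ S : Set E)) : β ∈ S := by
  -- The normal cone of the larger face is a face of `hull S`: if it contains a nonzero combination,
  -- it contains one of the generators used. Applied to `β`, this yields a generator on the ray of
  -- `β`.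
  have key : ∀ x ∈ PointedCone.hull ℝ S, x ∈ normalCone P (maxFace P β) → x ≠ 0 →
      ∃ s ∈ S, s ∈ normalCone P (maxFace P β) := by
    intro x hx
    induction hx using Submodule.span_induction with
    | mem x hx => exact fun hN _ => ⟨x, hx, hN⟩
    | zero => exact fun _ h0 => absurd rfl h0
    | add y z hy hz ihy ihz =>
      intro hN h0
      have hy' : y ∈ normalCone P (maxFace P u) := by rw [hcone]; exact hy
      have hz' : z ∈ normalCone P (maxFace P u) := by rw [hcone]; exact hz
      by_cases hy0 : y = 0
      · refine ihz ?_ fun hz0 => h0 (by rw [hy0, hz0, add_zero])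
        rw [add_comm] at hN
        exact mem_normalCone_of_add_mem (maxFace_subset _ _) hsub hne hz' hy' hN
      · exact ihy (mem_normalCone_of_add_mem (maxFace_subset _ _) hsub hne hy' hz' hN) hy0
    | smul c y hy ih =>
      intro hN h0
      have hc : c ≠ 0 := by rintro rfl; exact h0 (zero_smul _ _)
      refine ih ?_ fun hy0 => h0 (by rw [hy0, smul_zero])
      have := smul_mem_normalCone hN (c := (c : ℝ)⁻¹) (inv_nonneg.2 c.2)
      have hsm : (c : ℝ)⁻¹ • (c • y) = y := by
        change (c : ℝ)⁻¹ • ((c : ℝ) • y) = y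
        rw [smul_smul, inv_mul_cancel₀ (fun h0 => hc (Subtype.ext h0)), one_smul]
      rwa [hsm] at this
  have hβmem : β ∈ PointedCone.hull ℝ S := by
    rw [← SetLike.mem_coe, ← hcone]
    exact fun x hx y hy => (hsub hx).2 y hy
  obtain ⟨s, hsS, hsN⟩ := key β hβmem (mem_normalCone_maxFace P β) (h.ne_zero β hβ)
  obtain ⟨c, hc, hcs⟩ := (h.mem_normalCone_maxFace_iff hβ).1 hsN
  have hsΦ := h.subset S hS hsS
  rcases hc.lt_or_eq with hc | rfl
  · rwa [← h.eq_of_smul β hβ s hsΦ c hc hcs.symm]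
  · exact absurd (by rw [← hcs, zero_smul]) (h.ne_zero s hsΦ)

/-- A common point maximizes `β + γ`, and then the face of `β + γ` lies in both faces. Hence both
rays lie in the cone of that face and are vertices of its simplex. -/
lemma maxFace_inter_nonempty_iff {β γ : E} (hβ : β ∈ Φ) (hγ : γ ∈ Φ) :
    (maxFace P β ∩ maxFace P γ).Nonempty ↔ ∃ S ∈ C, β ∈ S ∧ γ ∈ S := by
  constructor
  · rintro ⟨x, hxβ, hxγ⟩
    have hx : x ∈ maxFace P (β + γ) := ⟨hxβ.1, fun y hy => by
      rw [inner_add_left, inner_add_left]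
      exact add_le_add (hxβ.2 y hy) (hxγ.2 y hy)⟩
    obtain ⟨S, hS, hcone⟩ := h.exists_simplex ⟨x, hx⟩
    have hle : ∀ z ∈ maxFace P (β + γ), ⟪β, x⟫ ≤ ⟪β, z⟫ ∧ ⟪γ, x⟫ ≤ ⟪γ, z⟫ := by
      intro z hz
      have h1 := hz.2 x hx.1
      rw [inner_add_left, inner_add_left] at h1
      have h2 := hxβ.2 z hz.1
      have h3 := hxγ.2 z hz.1
      constructor <;> linarith
    refine ⟨S, hS, h.mem_of_subset_maxFace hβ ⟨x, hx⟩ (fun z hz => ?_) hS hcone,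
      h.mem_of_subset_maxFace hγ ⟨x, hx⟩ (fun z hz => ?_) hS hcone⟩
    · exact ⟨hz.1, fun y hy => (hxβ.2 y hy).trans (hle z hz).1⟩
    · exact ⟨hz.1, fun y hy => (hxγ.2 y hy).trans (hle z hz).2⟩
  · rintro ⟨S, hS, hβS, hγS⟩
    obtain ⟨u, ⟨x, hx⟩, hcone⟩ := h.exists_maxFace hS
    have hmem : ∀ δ ∈ S, x ∈ maxFace P δ := fun δ hδ =>
      maxFace_subset_of_mem_normalCone (by rw [hcone]; exact PointedCone.subset_hull hδ) hx
    exact ⟨x, hmem β hβS, hmem γ hγS⟩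

/-- If moreover proportional vectors of `Φ` are equal or opposite, then the special facets are
those whose normals are in `Φ` together with their opposites. -/
lemma mem_specialFacets_iff (hopp : ∀ β ∈ Φ, ∀ γ ∈ Φ, ∀ c : ℝ, c < 0 → γ = c • β → γ = -β)
    {F : Set E} : F ∈ specialFacets P ↔ ∃ β ∈ Φ, -β ∈ Φ ∧ F = maxFace P β := by
  constructor
  · rintro ⟨hF, F', hF', hne, hpar⟩
    obtain ⟨β, hβ, rfl⟩ := h.isFacet_iff.1 hF
    obtain ⟨γ, hγ, rfl⟩ := h.isFacet_iff.1 hF'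
    refine ⟨β, hβ, ?_, rfl⟩
    rw [parallel_iff_orthogonal_eq (h.maxFace_nonempty hβ) (h.maxFace_nonempty hγ),
      h.orthogonal_vectorSpan_maxFace hβ, h.orthogonal_vectorSpan_maxFace hγ] at hpar
    have hmem : γ ∈ Submodule.span ℝ {β} := by
      rw [hpar]; exact Submodule.mem_span_singleton_self γ
    obtain ⟨c, hc⟩ := Submodule.mem_span_singleton.1 hmem
    rcases lt_trichotomy c 0 with hc0 | rfl | hc0
    · rwa [← hopp β hβ γ hγ c hc0 hc.symm]
    · exact absurd (by rw [← hc, zero_smul]) (h.ne_zero γ hγ)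
    · exact absurd (by rw [h.eq_of_smul β hβ γ hγ c hc0 hc.symm]) hne
  · rintro ⟨β, hβ, hβ', rfl⟩
    refine ⟨h.isFacet_maxFace hβ, maxFace P (-β), h.isFacet_maxFace hβ', fun heq => ?_, ?_⟩
    · have := h.eq_of_maxFace_eq hβ' hβ heq
      rw [neg_eq_iff_add_eq_zero, ← two_smul ℝ, smul_eq_zero] at this
      exact h.ne_zero β hβ (this.resolve_left two_ne_zero)
    · rw [parallel_iff_orthogonal_eq (h.maxFace_nonempty hβ) (h.maxFace_nonempty hβ'),
        h.orthogonal_vectorSpan_maxFace hβ, h.orthogonal_vectorSpan_maxFace hβ',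
        ← Set.neg_singleton, Submodule.span_neg]

end HasSimplicialNormalFan

end SimplicialNormalFan

/-! ### Almost positive roots and their opposites -/

section Roots

variable {n : ℕ}

lemma root_apply (i j k : Fin (n + 1)) :
    (root i j : EuclideanSpace ℝ (Fin (n + 1))) k =
      (if k = i then 1 else 0) - if k = j then 1 else 0 := by
  simp [root]

lemma neg_root (i j : Fin (n + 1)) : -root i j = root j i := by
  simp [root, Subtype.ext_iff]

/-- The positive and the negative entry of a root mark its two indices, and positive scaling keeps
the signs. -/
lemma eq_of_root_eq_smul {i j k l : Fin (n + 1)} (hkl : k ≠ l) {c : ℝ} (hc : 0 < c)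
    (h : root k l = c • root i j) : k = i ∧ l = j := by
  have hap : ∀ m, (root k l : EuclideanSpace ℝ (Fin (n + 1))) m =
      c * (root i j : EuclideanSpace ℝ (Fin (n + 1))) m := fun m => by rw [h]; rfl
  have h1 := hap k
  have h2 := hap l
  simp only [root_apply, if_true, if_neg hkl, if_neg hkl.symm] at h1 h2
  constructor
  · by_contra hki
    rw [if_neg hki] at h1
    split_ifs at h1 <;> linarith
  · by_contra hlj
    rw [if_neg hlj] at h2
    split_ifs at h2 <;> linarith

lemma root_ne_zero {i j : Fin (n + 1)} (hij : i ≠ j) : root i j ≠ 0 := by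
  intro h
  have : (root i j : EuclideanSpace ℝ (Fin (n + 1))) i = 0 := by rw [h]; rfl
  rw [root_apply] at this
  simp [hij] at this

lemma root_inj {i j k l : Fin (n + 1)} (hkl : k ≠ l) :
    root k l = root i j ↔ k = i ∧ l = j :=
  ⟨fun h => eq_of_root_eq_smul hkl one_pos (by rw [h, one_smul]), by rintro ⟨rfl, rfl⟩; rfl⟩

lemma neg_simpleRoot (i : Fin n) : -simpleRoot i = root i.succ i.castSucc := neg_root _ _

/-- The condition `i ≤ j + 1` with `i ≠ j` covers both kinds at once: `i < j` for positive roots, `i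
= j + 1` for negative simple ones. Imposing it also on the opposite root leaves only adjacent
indices. -/
lemma mem_almostPositiveRoots_iff {β : sumZero n} :
    β ∈ almostPositiveRoots n ↔ ∃ i j : Fin (n + 1), i ≠ j ∧ (i : ℕ) ≤ j + 1 ∧ β = root i j := by
  constructor
  · rintro (⟨i, j, hij, rfl⟩ | ⟨i, rfl⟩)
    · exact ⟨i, j, hij.ne, by have : (i : ℕ) < j := hij; omega, rfl⟩
    · exact ⟨i.succ, i.castSucc, i.castSucc_lt_succ.ne', by simp, neg_simpleRoot i⟩
  · rintro ⟨i, j, hne, hle, rfl⟩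
    rcases lt_or_gt_of_ne hne with hlt | hgt
    · exact Or.inl ⟨i, j, hlt, rfl⟩
    · have hgt' : (j : ℕ) < i := hgt
      have hj : (j : ℕ) < n := by have := i.isLt; omega
      refine Or.inr ⟨⟨j, hj⟩, ?_⟩
      rw [neg_simpleRoot]
      congr 1
      ext
      simp only [Fin.val_succ]
      omega

/-- The simple roots and their negatives. -/
noncomputable def signedSimpleRoot : Fin n × Bool → sumZero n
  | (i, true) => simpleRoot i
  | (i, false) => -simpleRoot i

lemma signedSimpleRoot_injective : Function.Injective (signedSimpleRoot (n := n)) := by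
  have hpos : ∀ i : Fin n, signedSimpleRoot (i, true) = root i.castSucc i.succ := fun _ => rfl
  have hneg : ∀ i : Fin n, signedSimpleRoot (i, false) = root i.succ i.castSucc := neg_simpleRoot
  rintro ⟨i, _ | _⟩ ⟨j, _ | _⟩ h <;>
    simp only [hpos, hneg] at h <;>
    rw [root_inj (by simp [Fin.ext_iff])] at h <;>
    simp only [Fin.ext_iff, Fin.val_succ, Fin.val_castSucc] at h
  · rw [Fin.ext h.2]
  · omega
  · omega
  · rw [Fin.ext h.1]

lemma mem_almostPositiveRoots_and_neg_mem_iff {β : sumZero n} :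
    β ∈ almostPositiveRoots n ∧ -β ∈ almostPositiveRoots n ↔ ∃ p, β = signedSimpleRoot p := by
  constructor
  · rintro ⟨h1, h2⟩
    obtain ⟨i, j, hij, hle, rfl⟩ := mem_almostPositiveRoots_iff.1 h1
    obtain ⟨k, l, hkl, hle', heq⟩ := mem_almostPositiveRoots_iff.1 h2
    rw [neg_root, root_inj hij.symm] at heq
    obtain ⟨rfl, rfl⟩ := heq
    have hij' : (i : ℕ) ≠ j := fun h => hij (Fin.ext h)
    have := i.isLt
    have := j.isLt
    rcases Nat.lt_or_ge i j with hlt | hge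
    · refine ⟨(⟨i, by omega⟩, true), ?_⟩
      simp only [signedSimpleRoot, simpleRoot]
      congr 1
      ext
      simp only [Fin.val_succ]
      omega
    · refine ⟨(⟨j, by omega⟩, false), ?_⟩
      simp only [signedSimpleRoot, neg_simpleRoot]
      congr 1
      ext
      simp only [Fin.val_succ]
      omega
  · have hpos : ∀ i : Fin n, simpleRoot i ∈ almostPositiveRoots n := fun i =>
      Or.inl ⟨_, _, i.castSucc_lt_succ, rfl⟩
    have hneg : ∀ i : Fin n, -simpleRoot i ∈ almostPositiveRoots n := fun i => Or.inr ⟨i, rfl⟩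
    rintro ⟨⟨i, _ | _⟩, rfl⟩
    · exact ⟨hneg i, by simpa [signedSimpleRoot] using hpos i⟩
    · exact ⟨hpos i, hneg i⟩

lemma eq_neg_of_eq_smul_of_neg {β γ : sumZero n} (hβ : β ∈ almostPositiveRoots n)
    (hγ : γ ∈ almostPositiveRoots n) {c : ℝ} (hc : c < 0) (h : γ = c • β) : γ = -β := by
  obtain ⟨i, j, hij, -, rfl⟩ := mem_almostPositiveRoots_iff.1 hβ
  obtain ⟨k, l, hkl, -, rfl⟩ := mem_almostPositiveRoots_iff.1 hγ
  rw [neg_root, root_inj hkl]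
  refine eq_of_root_eq_smul hkl (neg_pos.2 hc) ?_
  rw [h, ← neg_root i j, smul_neg, neg_smul, neg_neg]

end Roots

/-! ### Crossings of the diagonals of simple roots and their negatives -/

section Diagonals

variable {n : ℕ}

lemma Crosses.symm {d e : Diagonal n} (h : Crosses d e) : Crosses e d := Or.symm h

lemma not_crosses_snake (i j : Fin n) : ¬ Crosses (snake i) (snake j) := by
  have := i.isLt
  have := j.isLt
  simp only [Crosses, snake]
  omega

/-- The diagonal that replaces the `i`-th diagonal of the snake in the flip of the snake
triangulation. -/
def snakeFlip (i : Fin n) : Diagonal n where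
  -- The even formula at `i = 0` would give endpoints 2 and n + 3; the latter is vertex 0 of the
  -- polygon, so the pair is reordered.
  lo := if (i : ℕ) = 0 then 0 else if (i : ℕ) % 2 = 0 then (i : ℕ) / 2 + 2 else (i : ℕ) / 2 + 1
  hi := if (i : ℕ) = 0 then 2 else if (i : ℕ) % 2 = 0 then n + 3 - (i : ℕ) / 2 else n + 1 - (i : ℕ) / 2
  hi_le := by have := i.isLt; split_ifs <;> omega
  lo_hi := by have := i.isLt; split_ifs <;> omega
  not_edge := by
    have := i.isLt
    rintro ⟨h1, h2⟩
    split_ifs at h1 h2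
    all_goals omega

lemma crosses_snakeFlip_snake (i k : Fin n) : Crosses (snakeFlip i) (snake k) ↔ k = i := by
  have := i.isLt
  have := k.isLt
  rw [Fin.ext_iff]
  simp only [Crosses, snake, snakeFlip]
  split_ifs <;> omega

lemma crosses_snakeFlip (i j : Fin n) : Crosses (snakeFlip i) (snakeFlip j) ↔
    (i : ℕ) = j + 1 ∨ (j : ℕ) = i + 1 := by
  have := i.isLt
  have := j.isLt
  simp only [Crosses, snakeFlip]
  split_ifs <;> omega

/-- Here `i = 2m + 1`, its snake diagonal is (m + 2, N + 1), and those before and after it are (m +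
1, N + 1) and (m + 2, N). When no later one exists, the bound on `n` replaces its constraint. -/
lemma eq_of_crosses_only_middle_odd {x y m n N : ℕ} (hN : n + 1 = N + m)
    (h0 : x < m + 2 ∧ m + 2 < y ∧ y < N + 1 ∨ m + 2 < x ∧ x < N + 1 ∧ N + 1 < y)
    (hpred : ¬ (x < m + 1 ∧ m + 1 < y ∧ y < N + 1) ∧ ¬ (m + 1 < x ∧ x < N + 1 ∧ N + 1 < y))
    (hsucc : 2 * m + 2 < n → ¬ (x < m + 2 ∧ m + 2 < y ∧ y < N)) (hm : 2 * m + 1 < n) :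
    x = m + 1 ∧ y = N := by
  rcases h0 with ⟨h1, h2, h3⟩ | ⟨h1, h2, h3⟩
  · have hx : m + 1 ≤ x := not_lt.1 fun h => hpred.1 ⟨h, by omega, h3⟩
    have hy : N ≤ y := by
      rcases Nat.lt_or_ge (2 * m + 2) n with hlt | hge
      · exact not_lt.1 fun h => hsucc hlt ⟨h1, h2, h⟩
      · omega
    exact ⟨by omega, by omega⟩
  · exact absurd ⟨by omega, h2, h3⟩ hpred.2

lemma eq_of_crosses_only_middle_even {x y m n N : ℕ} (hN : n + 2 = N + m)
    (h0 : x < m + 1 ∧ m + 1 < y ∧ y < N ∨ m + 1 < x ∧ x < N ∧ N < y)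
    (hpred : ¬ (x < m + 1 ∧ m + 1 < y ∧ y < N + 1) ∧ ¬ (m + 1 < x ∧ x < N + 1 ∧ N + 1 < y))
    (hsucc : 2 * m + 1 < n → ¬ (m + 2 < x ∧ x < N ∧ N < y)) (hm : 2 * m < n) :
    x = m + 2 ∧ y = N + 1 := by
  rcases h0 with ⟨h1, h2, h3⟩ | ⟨h1, h2, h3⟩
  · exact absurd ⟨h1, h2, by omega⟩ hpred.1
  · have hy : y ≤ N + 1 := not_lt.1 fun h => hpred.2 ⟨h1, by omega, h⟩
    have hx : x ≤ m + 2 := by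
      rcases Nat.lt_or_ge (2 * m + 1) n with hlt | hge
      · exact not_lt.1 fun h => hsucc hlt ⟨h, h2, h3⟩
      · omega
    exact ⟨by omega, by omega⟩

lemma eq_of_crosses_only_first {x y n : ℕ}
    (h0 : x < 1 ∧ 1 < y ∧ y < n + 2 ∨ 1 < x ∧ x < n + 2 ∧ n + 2 < y)
    (hsucc : 1 < n → ¬ (x < 2 ∧ 2 < y ∧ y < n + 2)) (hy : y ≤ n + 2) :
    x = 0 ∧ y = 2 := by
  rcases h0 with ⟨h1, h2, h3⟩ | ⟨h1, h2, h3⟩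
  · have hy : y ≤ 2 := by
      rcases Nat.lt_or_ge 1 n with hlt | hge
      · exact not_lt.1 fun h => hsucc hlt ⟨by omega, h, h3⟩
      · omega
    exact ⟨by omega, by omega⟩
  · omega

/-- Crossing the `i`-th snake diagonal while avoiding just its neighbors in the snake already fixes
both endpoints. This uniqueness is needed because `CorrespondsTo` is only a relation. -/
lemma eq_snakeFlip {i : Fin n} {d : Diagonal n} (h : ∀ k, Crosses d (snake k) ↔ k = i) :
    d = snakeFlip i := by
  have h0 : Crosses d (snake i) := (h i).2 rfl
  have hn : ∀ k : ℕ, k < n → k ≠ i → ¬ (d.lo < (k + 1) / 2 + 1 ∧ (k + 1) / 2 + 1 < d.hi ∧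
      d.hi < n + 2 - k / 2) ∧ ¬ ((k + 1) / 2 + 1 < d.lo ∧ d.lo < n + 2 - k / 2 ∧
      n + 2 - k / 2 < d.hi) := by
    intro k hk hki
    have := mt (h ⟨k, hk⟩).1 (fun h => hki (by rw [← h]))
    simpa only [Crosses, snake, not_or] using this
  have hi := i.isLt
  obtain ⟨x, y, h1, h2, h3⟩ := d
  simp only [snakeFlip, Diagonal.mk.injEq]
  simp only [Crosses, snake] at h0 hn
  obtain ⟨m, hm | hm⟩ := Nat.even_or_odd' (i : ℕ)
  · rcases Nat.eq_zero_or_pos m with rfl | hpos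
    · have hi0 : (i : ℕ) = 0 := hm
      simp only [hi0] at h0
      simp only [hi0, if_true]
      exact eq_of_crosses_only_first (by simpa using h0)
        (fun hlt => by simpa using (hn 1 hlt (by omega)).1) h1
    · have hi0 : ¬ (i : ℕ) = 0 := by omega
      have hi1 : (i : ℕ) % 2 = 0 := by omega
      simp only [hi0, hi1, if_true, if_false]
      obtain ⟨N, hN⟩ : ∃ N, n + 2 = N + m := ⟨n + 2 - m, by omega⟩
      have e0 : n + 2 - m = N := by omega
      have e1 : (2 * m + 1) / 2 = m := by omega
      have e2 : 2 * m / 2 = m := by omega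
      have e3 : (2 * m + 1 + 1) / 2 = m + 1 := by omega
      have e4 : (2 * m - 1 + 1) / 2 = m := by omega
      have e5 : (2 * m - 1) / 2 = m - 1 := by omega
      have e6 : n + 2 - (m - 1) = N + 1 := by omega
      have e7 : n + 3 - m = N + 1 := by omega
      have hpred := hn (2 * m - 1) (by omega) (by omega)
      have hsucc : 2 * m + 1 < n → _ := fun h => (hn (2 * m + 1) h (by omega)).2
      rw [e4, e5, e6] at hpred
      rw [e1, e3, e0] at hsucc
      rw [hm, e1, e2, e0] at h0
      rw [hm, e2, e7]
      exact eq_of_crosses_only_middle_even hN h0 hpred hsucc (by omega)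
  · have hi0 : ¬ (i : ℕ) = 0 := by omega
    have hi1 : ¬ (i : ℕ) % 2 = 0 := by omega
    simp only [hi0, hi1, if_false]
    obtain ⟨N, hN⟩ : ∃ N, n + 1 = N + m := ⟨n + 1 - m, by omega⟩
    have e0 : n + 2 - m = N + 1 := by omega
    have e1 : (2 * m + 1) / 2 = m := by omega
    have e2 : (2 * m + 1 + 1) / 2 = m + 1 := by omega
    have e3 : (2 * m + 2 + 1) / 2 = m + 1 := by omega
    have e4 : (2 * m + 2) / 2 = m + 1 := by omega
    have e5 : 2 * m / 2 = m := by omega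
    have e6 : n + 2 - (m + 1) = N := by omega
    have e7 : n + 1 - m = N := by omega
    have hpred := hn (2 * m) (by omega) (by omega)
    have hsucc : 2 * m + 2 < n → _ := fun h => (hn (2 * m + 2) h (by omega)).1
    rw [e1, e5, e0] at hpred
    rw [e3, e4, e6] at hsucc
    rw [hm, e1, e2, e0] at h0
    rw [hm, e1, e7]
    exact eq_of_crosses_only_middle_odd hN h0 hpred hsucc (by omega)

lemma correspondsTo_neg_simpleRoot {i : Fin n} {d : Diagonal n} :
    CorrespondsTo (-simpleRoot i) d ↔ d = snake i := by
  constructor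
  · rintro (⟨j, hj, rfl⟩ | ⟨j, k, hjk, heq, -⟩)
    · have : (i, false) = (j, false) := signedSimpleRoot_injective hj
      rw [(Prod.mk.inj this).1]
    · exfalso
      have hjk' : (j : ℕ) ≤ k := hjk
      rw [neg_simpleRoot, root_inj (by simp [Fin.ext_iff])] at heq
      simp only [Fin.ext_iff, Fin.val_succ, Fin.val_castSucc] at heq
      omega
  · rintro rfl
    exact Or.inl ⟨i, rfl, rfl⟩

lemma correspondsTo_simpleRoot {i : Fin n} {d : Diagonal n} :
    CorrespondsTo (simpleRoot i) d ↔ d = snakeFlip i := by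
  constructor
  · rintro (⟨j, hj, rfl⟩ | ⟨j, k, hjk, heq, hd⟩)
    · have : (i, true) = (j, false) := signedSimpleRoot_injective hj
      simp at this
    · have hjk' : (j : ℕ) ≤ k := hjk
      rw [simpleRoot, root_inj (by simp [Fin.ext_iff])] at heq
      simp only [Fin.castSucc_inj, Fin.succ_inj] at heq
      obtain ⟨rfl, rfl⟩ := heq
      exact eq_snakeFlip fun k => by rw [hd k, le_antisymm_iff, and_comm]
  · rintro rfl
    exact Or.inr ⟨i, i, le_rfl, rfl, fun k => by
      rw [crosses_snakeFlip_snake, le_antisymm_iff, and_comm]⟩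

lemma Compatible.symm {β γ : sumZero n} (h : Compatible β γ) : Compatible γ β := by
  obtain ⟨d, e, hd, he, hde⟩ := h
  exact ⟨e, d, he, hd, fun hc => hde hc.symm⟩

/-- The diagonal of a simple root or the negative of a simple root. -/
def signedSnake : Fin n × Bool → Diagonal n
  | (i, true) => snakeFlip i
  | (i, false) => snake i

lemma compatible_signedSimpleRoot {p q : Fin n × Bool} :
    Compatible (signedSimpleRoot p) (signedSimpleRoot q) ↔
      ¬ Crosses (signedSnake p) (signedSnake q) := by
  have hcor : ∀ (p : Fin n × Bool) (d : Diagonal n),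
      CorrespondsTo (signedSimpleRoot p) d ↔ d = signedSnake p := by
    rintro ⟨i, _ | _⟩ d
    · exact correspondsTo_neg_simpleRoot
    · exact correspondsTo_simpleRoot
  constructor
  · rintro ⟨d, e, hd, he, hde⟩
    rwa [(hcor _ _).1 hd, (hcor _ _).1 he] at hde
  · exact fun h => ⟨_, _, (hcor _ _).2 rfl, (hcor _ _).2 rfl, h⟩

end Diagonals

/-! ### Special facets of the second type -/

section AssII

variable {n : ℕ} {P : Set (sumZero n)}

lemma IsAssII.hasSimplicialNormalFan (hP : IsAssII n P) :
    HasSimplicialNormalFan P (almostPositiveRoots n) (clusterComplex n) where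
  isPolytope := hP.1
  normalFan_eq := hP.2
  empty_mem := ⟨Set.empty_subset _, Set.pairwise_empty _⟩
  singleton_mem _ hβ := ⟨Set.singleton_subset_iff.2 hβ, Set.pairwise_singleton _ _⟩
  subset _ hS := hS.1
  ne_zero β hβ := by
    obtain ⟨i, j, hij, -, rfl⟩ := mem_almostPositiveRoots_iff.1 hβ
    exact root_ne_zero hij
  eq_of_smul β hβ γ hγ c hc h := by
    obtain ⟨i, j, hij, -, rfl⟩ := mem_almostPositiveRoots_iff.1 hβ
    obtain ⟨k, l, hkl, -, rfl⟩ := mem_almostPositiveRoots_iff.1 hγ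
    obtain ⟨rfl, rfl⟩ := eq_of_root_eq_smul hkl hc h
    rfl

/-- The special facet of an associahedron of the second type with the given normal vector. -/
def specialFacetII (P : Set (sumZero n)) (p : Fin n × Bool) : Set (sumZero n) :=
  maxFace P (signedSimpleRoot p)

lemma signedSimpleRoot_mem (p : Fin n × Bool) : signedSimpleRoot p ∈ almostPositiveRoots n :=
  (mem_almostPositiveRoots_and_neg_mem_iff.2 ⟨p, rfl⟩).1

lemma IsAssII.specialFacetII_injective (hP : IsAssII n P) :
    Function.Injective (specialFacetII P) := fun p q h =>
  signedSimpleRoot_injective (hP.hasSimplicialNormalFan.eq_of_maxFace_eq (signedSimpleRoot_mem p)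
    (signedSimpleRoot_mem q) h)

lemma IsAssII.specialFacets_eq (hP : IsAssII n P) :
    specialFacets P = Set.range (specialFacetII P) := by
  ext F
  rw [hP.hasSimplicialNormalFan.mem_specialFacets_iff
    fun β hβ γ hγ c hc => eq_neg_of_eq_smul_of_neg hβ hγ hc]
  constructor
  · rintro ⟨β, h1, h2, rfl⟩
    obtain ⟨p, rfl⟩ := mem_almostPositiveRoots_and_neg_mem_iff.1 ⟨h1, h2⟩
    exact ⟨p, rfl⟩
  · rintro ⟨p, rfl⟩
    obtain ⟨h1, h2⟩ := mem_almostPositiveRoots_and_neg_mem_iff.2 ⟨p, rfl⟩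
    exact ⟨_, h1, h2, rfl⟩

lemma IsAssII.specialFacetII_inter_nonempty_iff (hP : IsAssII n P) {p q : Fin n × Bool}
    (hpq : p ≠ q) : (specialFacetII P p ∩ specialFacetII P q).Nonempty ↔
      ¬ Crosses (signedSnake p) (signedSnake q) := by
  rw [specialFacetII, specialFacetII, hP.hasSimplicialNormalFan.maxFace_inter_nonempty_iff
    (signedSimpleRoot_mem p) (signedSimpleRoot_mem q), ← compatible_signedSimpleRoot]
  constructor
  · rintro ⟨S, hS, hp, hq⟩
    exact hS.2 hp hq (signedSimpleRoot_injective.ne hpq)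
  · intro h
    refine ⟨{signedSimpleRoot p, signedSimpleRoot q}, ⟨?_, ?_⟩, by simp, by simp⟩
    · rintro β (rfl | rfl)
      · exact signedSimpleRoot_mem p
      · exact signedSimpleRoot_mem q
    · exact Set.pairwise_pair.2 fun _ => ⟨h, h.symm⟩

lemma IsAssII.ncard_specialNeighbors_neg (hP : IsAssII n P) (i : Fin n) :
    (specialNeighbors P (specialFacetII P (i, false))).ncard = (n - 1) + (n - 1) := by
  rw [ncard_specialNeighbors hP.specialFacetII_injective hP.specialFacets_eq, ncard_set_prod_bool]
  congr 1
  · rw [← ncard_ne i]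
    congr 1
    ext j
    simp only [Set.mem_ofPred_eq]
    rw [and_congr_right fun h => hP.specialFacetII_inter_nonempty_iff h.symm]
    have : Crosses (snake i) (snakeFlip j) ↔ i = j :=
      ⟨fun h => (crosses_snakeFlip_snake j i).1 h.symm,
        fun h => ((crosses_snakeFlip_snake j i).2 h).symm⟩
    simp [signedSnake, this, eq_comm]
  · rw [← ncard_ne i]
    congr 1
    ext j
    simp only [Set.mem_ofPred_eq]
    rw [and_congr_right fun h => hP.specialFacetII_inter_nonempty_iff h.symm]
    simp [signedSnake, not_crosses_snake]

lemma IsAssII.ncard_specialNeighbors_pos (hP : IsAssII n P) (i : Fin n) :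
    (specialNeighbors P (specialFacetII P (i, true))).ncard =
      {j : Fin n | (i : ℕ) + 2 ≤ j ∨ (j : ℕ) + 2 ≤ i}.ncard + (n - 1) := by
  rw [ncard_specialNeighbors hP.specialFacetII_injective hP.specialFacets_eq, ncard_set_prod_bool]
  congr 1
  · congr 1
    ext j
    simp only [Set.mem_ofPred_eq]
    rw [and_congr_right fun h => hP.specialFacetII_inter_nonempty_iff h.symm]
    simp only [signedSnake, crosses_snakeFlip, ne_eq, Prod.mk.injEq, and_true, Fin.ext_iff]
    omega
  · rw [← ncard_ne i]
    congr 1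
    ext j
    simp only [Set.mem_ofPred_eq]
    rw [and_congr_right fun h => hP.specialFacetII_inter_nonempty_iff h.symm]
    simp [signedSnake, crosses_snakeFlip_snake]

lemma IsAssII.ncard_specialNeighbors_pos_eq_iff (hP : IsAssII n P) (i : Fin n) :
    (specialNeighbors P (specialFacetII P (i, true))).ncard = n - 1 ↔
      ∀ j : Fin n, ¬ ((i : ℕ) + 2 ≤ j ∨ (j : ℕ) + 2 ≤ i) := by
  rw [hP.ncard_specialNeighbors_pos, Nat.add_eq_right, Set.ncard_eq_zero (Set.toFinite _),
    Set.eq_empty_iff_forall_notMem]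
  rfl

lemma IsAssII.lt_ncard_specialNeighbors (hP : IsAssII n P) (hn : 3 < n) {F : Set (sumZero n)}
    (hF : F ∈ specialFacets P) : n - 1 < (specialNeighbors P F).ncard := by
  rw [hP.specialFacets_eq] at hF
  obtain ⟨⟨i, _ | _⟩, rfl⟩ := hF
  · rw [hP.ncard_specialNeighbors_neg]
    omega
  · refine lt_of_le_of_ne ?_ fun h => ?_
    · rw [hP.ncard_specialNeighbors_pos]
      omega
    · have h := (hP.ncard_specialNeighbors_pos_eq_iff i).1 h.symm
      have h1 := h ⟨0, by omega⟩
      have h2 := h ⟨3, by omega⟩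
      simp only at h1 h2
      omega

lemma IsAssII.existsUnique_ncard_specialNeighbors_eq {P : Set (sumZero 3)} (hP : IsAssII 3 P) :
    ∃! F, F ∈ specialFacets P ∧ (specialNeighbors P F).ncard = 3 - 1 := by
  -- The middle simple root: no index in {0, 1, 2} is at distance 2 from 1.
  refine ⟨specialFacetII P (1, true), ⟨by rw [hP.specialFacets_eq]; exact ⟨_, rfl⟩, ?_⟩, ?_⟩
  · rw [hP.ncard_specialNeighbors_pos_eq_iff]
    decide
  · rintro F ⟨hF, hcard⟩
    rw [hP.specialFacets_eq] at hF
    obtain ⟨⟨i, _ | _⟩, rfl⟩ := hF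
    · rw [hP.ncard_specialNeighbors_neg] at hcard
      omega
    · rw [hP.ncard_specialNeighbors_pos_eq_iff] at hcard
      have h1 := hcard 0
      have h2 := hcard 2
      have hi : i = 1 := by
        simp only [Fin.ext_iff] at h1 h2 ⊢
        simp at h1 h2 ⊢
        omega
      rw [hi]

lemma IsAssII.ncard_specialFacets_with_le_one (hP : IsAssII n P) (hn : 3 ≤ n) :
    {F ∈ specialFacets P | (specialNeighbors P F).ncard = n - 1}.ncard ≤ 1 := by
  have hfin : (specialFacets P).Finite := by
    rw [hP.specialFacets_eq]; exact Set.finite_range _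
  rw [Set.ncard_le_one (hfin.subset (Set.sep_subset _ _))]
  rintro F ⟨hF, hF'⟩ G ⟨hG, hG'⟩
  rcases hn.eq_or_lt with rfl | hn
  · exact hP.existsUnique_ncard_specialNeighbors_eq.unique ⟨hF, hF'⟩ ⟨hG, hG'⟩
  · exact absurd hF' (hP.lt_ncard_specialNeighbors hn hF).ne'

end AssII

/-! ### Faces of Minkowski sums of coordinate simplices -/

section SimplexSum

variable {κ ι : Type*} [Fintype κ] [DecidableEq κ]

lemma exists_coord_of_mem_convexHull_single {A : Set κ} {z : EuclideanSpace ℝ κ}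
    (hz : z ∈ convexHull ℝ ((fun k => EuclideanSpace.single k (1 : ℝ)) '' A)) :
    (∀ k, 0 ≤ z k) ∧ ∑ k, z k = 1 ∧ ∀ k, z k ≠ 0 → k ∈ A := by
  have hconv : Convex ℝ {z : EuclideanSpace ℝ κ |
      (∀ k, 0 ≤ z k) ∧ ∑ k, z k = 1 ∧ ∀ k, z k ≠ 0 → k ∈ A} := by
    rintro x ⟨hx0, hx1, hxA⟩ y ⟨hy0, hy1, hyA⟩ b c hb hc hbc
    refine ⟨fun k => ?_, ?_, fun k hk => ?_⟩
    · simp only [PiLp.add_apply, PiLp.smul_apply, smul_eq_mul]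
      exact add_nonneg (mul_nonneg hb (hx0 k)) (mul_nonneg hc (hy0 k))
    · simp [Finset.sum_add_distrib, ← Finset.mul_sum, hx1, hy1, hbc]
    · by_contra hkA
      have h1 : x k = 0 := by_contra fun h => hkA (hxA k h)
      have h2 : y k = 0 := by_contra fun h => hkA (hyA k h)
      simp [h1, h2] at hk
  refine convexHull_min ?_ hconv hz
  rintro _ ⟨k, hk, rfl⟩
  refine ⟨fun l => ?_, by simp, fun l hl => ?_⟩
  · simp only [PiLp.single_apply]
    split_ifs <;> norm_num
  · simp only [PiLp.single_apply, ne_eq, ite_eq_right_iff, one_ne_zero,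
      imp_false, not_not] at hl
    rwa [hl]

omit [DecidableEq κ] in
lemma real_inner_eq_sum (u x : EuclideanSpace ℝ κ) : ⟪u, x⟫ = ∑ k, u k * x k := by
  simp [PiLp.inner_apply, mul_comm]

/-- The Minkowski sum of the simplices `a t • conv {e_k : k ∈ A t}`. -/
noncomputable def simplexSum (T : Finset ι) (a : ι → ℝ) (A : ι → Set κ) :
    Set (EuclideanSpace ℝ κ) :=
  ∑ t ∈ T, a t • convexHull ℝ ((fun k => EuclideanSpace.single k (1 : ℝ)) '' A t)

/-- The indices in `A` at which the coordinates of `u` are maximal. -/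
def argmaxOn (u : EuclideanSpace ℝ κ) (A : Set κ) : Set κ := {k ∈ A | ∀ l ∈ A, u l ≤ u k}

/-- The point of the Minkowski sum obtained by choosing a vertex of each simplex. -/
noncomputable def simplexSumPoint (T : Finset ι) (a : ι → ℝ) (σ : ι → κ) : EuclideanSpace ℝ κ :=
  ∑ t ∈ T, a t • EuclideanSpace.single (σ t) (1 : ℝ)

omit [DecidableEq κ] in
lemma argmaxOn_nonempty (u : EuclideanSpace ℝ κ) {A : Set κ} (hA : A.Nonempty) :
    (argmaxOn u A).Nonempty := by
  obtain ⟨k, hk, h⟩ := Set.exists_max_image A (fun k => u k) A.toFinite hA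
  exact ⟨k, hk, h⟩

lemma inner_simplexSumPoint (T : Finset ι) (a : ι → ℝ) (σ : ι → κ) (u : EuclideanSpace ℝ κ) :
    ⟪u, simplexSumPoint T a σ⟫ = ∑ t ∈ T, a t * u (σ t) := by
  simp [simplexSumPoint, inner_sum, inner_smul_right, EuclideanSpace.inner_single_right]

variable {T : Finset ι} {a : ι → ℝ} {A : ι → Set κ}

omit [Fintype κ] in
lemma simplexSumPoint_mem {σ : ι → κ} (hσ : ∀ t ∈ T, σ t ∈ A t) :
    simplexSumPoint T a σ ∈ simplexSum T a A :=
  Set.finsetSum_mem_finsetSum T _ _ fun t ht =>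
    Set.smul_mem_smul_set (subset_convexHull ℝ _ ⟨σ t, hσ t ht, rfl⟩)

lemma exists_sum_of_mem_simplexSum {x : EuclideanSpace ℝ κ} (hx : x ∈ simplexSum T a A) :
    ∃ z : ι → EuclideanSpace ℝ κ, x = ∑ t ∈ T, a t • z t ∧
      ∀ t ∈ T, (∀ k, 0 ≤ z t k) ∧ ∑ k, z t k = 1 ∧ ∀ k, z t k ≠ 0 → k ∈ A t := by
  obtain ⟨g, hg, rfl⟩ := (Set.mem_finsetSum _ _ _).1 hx
  have : ∀ t, ∃ y, t ∈ T →
      y ∈ convexHull ℝ ((fun k => EuclideanSpace.single k (1 : ℝ)) '' A t) ∧ a t • y = g t := by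
    intro t
    by_cases ht : t ∈ T
    · obtain ⟨y, hy, hyt⟩ := hg ht
      exact ⟨y, fun _ => ⟨hy, hyt⟩⟩
    · exact ⟨0, fun h => absurd h ht⟩
  choose z hz using this
  exact ⟨z, Finset.sum_congr rfl fun t ht => (hz t ht).2.symm,
    fun t ht => exists_coord_of_mem_convexHull_single (hz t ht).1⟩

omit [DecidableEq κ] in
lemma inner_eq_of_forall_coord {u z : EuclideanSpace ℝ κ} {c : ℝ} (hz1 : ∑ k, z k = 1)
    (hu : ∀ k, z k ≠ 0 → u k = c) : ⟪u, z⟫ = c := by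
  rw [real_inner_eq_sum]
  calc ∑ k, u k * z k = ∑ k, c * z k := Finset.sum_congr rfl fun k _ => by
        by_cases h : z k = 0
        · rw [h, mul_zero, mul_zero]
        · rw [hu k h]
    _ = c := by rw [← Finset.mul_sum, hz1, mul_one]

omit [DecidableEq κ] in
-- The inner product is a weighted average of coordinates of `u`, so reaching the bound forces
-- equality wherever the weight is nonzero.
lemma inner_le_of_forall_coord {u z : EuclideanSpace ℝ κ} {c : ℝ} (hz0 : ∀ k, 0 ≤ z k)
    (hz1 : ∑ k, z k = 1) (hu : ∀ k, z k ≠ 0 → u k ≤ c) :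
    ⟪u, z⟫ ≤ c ∧ (⟪u, z⟫ = c → ∀ k, z k ≠ 0 → u k = c) := by
  have hterm : ∀ k ∈ Finset.univ, u k * z k ≤ c * z k := fun k _ => by
    by_cases h : z k = 0
    · rw [h, mul_zero, mul_zero]
    · exact mul_le_mul_of_nonneg_right (hu k h) (hz0 k)
  have hc : ∑ k, c * z k = c := by rw [← Finset.mul_sum, hz1, mul_one]
  rw [real_inner_eq_sum]
  refine ⟨(Finset.sum_le_sum hterm).trans hc.le, fun h k hk => ?_⟩
  have := (Finset.sum_eq_sum_iff_of_le hterm).1 (h.trans hc.symm) k (Finset.mem_univ k)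
  exact mul_right_cancel₀ hk this

lemma simplexSumPoint_mem_maxFace (ha : ∀ t ∈ T, 0 < a t) {u : EuclideanSpace ℝ κ} {σ : ι → κ}
    (hσ : ∀ t ∈ T, σ t ∈ argmaxOn u (A t)) :
    simplexSumPoint T a σ ∈ maxFace (simplexSum T a A) u := by
  refine ⟨simplexSumPoint_mem fun t ht => (hσ t ht).1, fun y hy => ?_⟩
  obtain ⟨z, rfl, hz⟩ := exists_sum_of_mem_simplexSum hy
  rw [inner_simplexSumPoint, inner_sum]
  refine Finset.sum_le_sum fun t ht => ?_
  rw [inner_smul_right]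
  obtain ⟨h0, h1, hA⟩ := hz t ht
  exact mul_le_mul_of_nonneg_left
    (inner_le_of_forall_coord h0 h1 fun k hk => (hσ t ht).2 k (hA k hk)).1 (ha t ht).le

omit [DecidableEq κ] in
lemma exists_choice_argmaxOn (hA : ∀ t ∈ T, (A t).Nonempty) (hκ : Nonempty κ)
    (u : EuclideanSpace ℝ κ) : ∃ σ : ι → κ, ∀ t ∈ T, σ t ∈ argmaxOn u (A t) := by
  have : ∀ t, ∃ k, t ∈ T → k ∈ argmaxOn u (A t) := by
    intro t
    by_cases ht : t ∈ T
    · obtain ⟨k, hk⟩ := argmaxOn_nonempty u (hA t ht)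
      exact ⟨k, fun _ => hk⟩
    · exact ⟨hκ.some, fun h => absurd h ht⟩
  choose σ hσ using this
  exact ⟨σ, hσ⟩

lemma maxFace_simplexSum_nonempty (ha : ∀ t ∈ T, 0 < a t) (hA : ∀ t ∈ T, (A t).Nonempty)
    (hκ : Nonempty κ) (u : EuclideanSpace ℝ κ) : (maxFace (simplexSum T a A) u).Nonempty := by
  obtain ⟨σ, hσ⟩ := exists_choice_argmaxOn hA hκ u
  exact ⟨_, simplexSumPoint_mem_maxFace ha hσ⟩

/-- A decomposition of a point of the Minkowski sum is compatible with all faces containing the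
point. -/
lemma exists_sum_argmaxOn_of_mem_simplexSum (ha : ∀ t ∈ T, 0 < a t)
    (hA : ∀ t ∈ T, (A t).Nonempty) (hκ : Nonempty κ) {x : EuclideanSpace ℝ κ}
    (hx : x ∈ simplexSum T a A) :
    ∃ z : ι → EuclideanSpace ℝ κ, x = ∑ t ∈ T, a t • z t ∧
      (∀ t ∈ T, ∑ k, z t k = 1) ∧
      ∀ u, x ∈ maxFace (simplexSum T a A) u → ∀ t ∈ T, ∀ k, z t k ≠ 0 → k ∈ argmaxOn u (A t) := by
  obtain ⟨z, rfl, hz⟩ := exists_sum_of_mem_simplexSum hx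
  refine ⟨z, rfl, fun t ht => (hz t ht).2.1, fun u hu => ?_⟩
  obtain ⟨σ, hσ⟩ := exists_choice_argmaxOn hA hκ u
  -- Comparison with a vertex choice maximizing every summand: the termwise bounds then have equal
  -- sums, so each is an equality.
  have hle := hu.2 _ (simplexSumPoint_mem fun t ht => (hσ t ht).1)
  rw [inner_simplexSumPoint, inner_sum] at hle
  simp only [inner_smul_right] at hle
  have hterm : ∀ t ∈ T, ⟪u, z t⟫ ≤ u (σ t) ∧
      (⟪u, z t⟫ = u (σ t) → ∀ k, z t k ≠ 0 → u k = u (σ t)) := fun t ht =>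
    inner_le_of_forall_coord (hz t ht).1 (hz t ht).2.1 fun k hk =>
      (hσ t ht).2 k ((hz t ht).2.2 k hk)
  have hterm' : ∀ t ∈ T, a t * ⟪u, z t⟫ ≤ a t * u (σ t) := fun t ht =>
    mul_le_mul_of_nonneg_left (hterm t ht).1 (ha t ht).le
  have heq := (Finset.sum_eq_sum_iff_of_le hterm').1
    (le_antisymm (Finset.sum_le_sum hterm') hle)
  intro t ht k hk
  have h1 := (hterm t ht).2 (mul_left_cancel₀ (ha t ht).ne' (heq t ht)) k hk
  exact ⟨(hz t ht).2.2 k hk, fun l hl => h1 ▸ (hσ t ht).2 l hl⟩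

/-- A single decomposition of a common point serves both functionals, so the support of each summand
lies in both argmax sets. Conversely, common maximizers are chosen summand by summand. -/
lemma maxFace_simplexSum_inter_nonempty_iff (ha : ∀ t ∈ T, 0 < a t)
    (hA : ∀ t ∈ T, (A t).Nonempty) (hκ : Nonempty κ) {u v : EuclideanSpace ℝ κ} :
    (maxFace (simplexSum T a A) u ∩ maxFace (simplexSum T a A) v).Nonempty ↔
      ∀ t ∈ T, (argmaxOn u (A t) ∩ argmaxOn v (A t)).Nonempty := by
  constructor
  · rintro ⟨x, hu, hv⟩ t ht
    obtain ⟨z, -, h1, hz⟩ := exists_sum_argmaxOn_of_mem_simplexSum ha hA hκ hu.1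
    obtain ⟨k, -, hk⟩ := Finset.exists_ne_zero_of_sum_ne_zero
      ((h1 t ht).trans_ne one_ne_zero)
    exact ⟨k, hz u hu t ht k hk, hz v hv t ht k hk⟩
  · intro h
    have : ∀ t, ∃ k, t ∈ T → k ∈ argmaxOn u (A t) ∩ argmaxOn v (A t) := by
      intro t
      by_cases ht : t ∈ T
      · obtain ⟨k, hk⟩ := h t ht
        exact ⟨k, fun _ => hk⟩
      · exact ⟨hκ.some, fun h => absurd h ht⟩
    choose σ hσ using this
    exact ⟨simplexSumPoint T a σ, simplexSumPoint_mem_maxFace ha fun t ht => (hσ t ht).1,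
      simplexSumPoint_mem_maxFace ha fun t ht => (hσ t ht).2⟩

lemma mem_orthogonal_vectorSpan_maxFace_simplexSum (ha : ∀ t ∈ T, 0 < a t)
    (hA : ∀ t ∈ T, (A t).Nonempty) (hκ : Nonempty κ) {u w : EuclideanSpace ℝ κ} :
    w ∈ (vectorSpan ℝ (maxFace (simplexSum T a A) u))ᗮ ↔
      ∀ t ∈ T, ∀ k ∈ argmaxOn u (A t), ∀ l ∈ argmaxOn u (A t), w k = w l := by
  classical
  obtain ⟨σ, hσ⟩ := exists_choice_argmaxOn hA hκ u
  rw [mem_orthogonal_vectorSpan]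
  constructor
  · intro h t ht k hk l hl
    -- Moving the chosen vertex of the single summand `t` gives two points of the face whose
    -- difference isolates `w k - w l`.
    have hupd : ∀ m ∈ argmaxOn u (A t), ∀ s ∈ T, Function.update σ t m s ∈ argmaxOn u (A s) := by
      intro m hm s hs
      by_cases hst : s = t
      · subst hst; simpa using hm
      · simpa [hst] using hσ s hs
    have := h _ (simplexSumPoint_mem_maxFace ha (hupd k hk)) _
      (simplexSumPoint_mem_maxFace ha (hupd l hl))
    rw [inner_simplexSumPoint, inner_simplexSumPoint, ← sub_eq_zero, ← Finset.sum_sub_distrib,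
      Finset.sum_eq_single_of_mem t ht fun s _ hst => by simp [hst], ← mul_sub] at this
    simpa [(ha t ht).ne', sub_eq_zero] using this
  · intro h
    suffices ∀ x ∈ maxFace (simplexSum T a A) u, ⟪w, x⟫ = ∑ t ∈ T, a t * w (σ t) from
      fun x hx y hy => (this x hx).trans (this y hy).symm
    intro x hx
    obtain ⟨z, hxz, h1, hz⟩ := exists_sum_argmaxOn_of_mem_simplexSum ha hA hκ hx.1
    rw [hxz, inner_sum]
    refine Finset.sum_congr rfl fun t ht => ?_
    rw [inner_smul_right, inner_eq_of_forall_coord (h1 t ht) fun k hk =>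
      h t ht k (hz u hx t ht k hk) _ (hσ t ht)]

end SimplexSum

/-! ### Adding a functional that is constant on the polytope -/

section General

variable {E : Type*} [NormedAddCommGroup E] [InnerProductSpace ℝ E]

lemma maxFace_add_of_mem_orthogonal {P : Set E} {o : E} (ho : o ∈ (vectorSpan ℝ P)ᗮ) (u : E) :
    maxFace P (o + u) = maxFace P u := by
  rw [mem_orthogonal_vectorSpan] at ho
  ext x
  simp only [maxFace, inner_add_left, Set.mem_ofPred_eq]
  refine and_congr_right fun hx => forall₂_congr fun y hy => ?_
  rw [ho y hy x hx, add_le_add_iff_left]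

end General

/-! ### Facets and special facets of the third type -/

section AssIII

variable {n : ℕ} {a : Fin (n + 1) → Fin (n + 1) → ℝ}

lemma AssIII_eq_simplexSum (n : ℕ) (a : Fin (n + 1) → Fin (n + 1) → ℝ) :
    AssIII n a = simplexSum (Finset.univ.sigma fun i : Fin (n + 1) => Finset.Ici i)
      (fun t => a t.1 t.2) (fun t => Set.Icc t.1 t.2) := by
  rw [simplexSum, Finset.sum_sigma]
  rfl

lemma maxFace_AssIII_nonempty (ha : ∀ i j, i ≤ j → 0 < a i j)
    (u : EuclideanSpace ℝ (Fin (n + 1))) : (maxFace (AssIII n a) u).Nonempty := by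
  rw [AssIII_eq_simplexSum]
  exact maxFace_simplexSum_nonempty (fun t ht => ha _ _ (by simpa using ht))
    (fun t ht => Set.nonempty_Icc.2 (by simpa using ht)) ⟨0⟩ u

lemma maxFace_AssIII_inter_nonempty_iff (ha : ∀ i j, i ≤ j → 0 < a i j)
    {u v : EuclideanSpace ℝ (Fin (n + 1))} :
    (maxFace (AssIII n a) u ∩ maxFace (AssIII n a) v).Nonempty ↔
      ∀ i j, i ≤ j → (argmaxOn u (Set.Icc i j) ∩ argmaxOn v (Set.Icc i j)).Nonempty := by
  rw [AssIII_eq_simplexSum, maxFace_simplexSum_inter_nonempty_iff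
    (fun t ht => ha _ _ (by simpa using ht))
    (fun t ht => Set.nonempty_Icc.2 (by simpa using ht)) ⟨0⟩]
  simp [Sigma.forall]

lemma mem_orthogonal_vectorSpan_maxFace_AssIII (ha : ∀ i j, i ≤ j → 0 < a i j)
    {u w : EuclideanSpace ℝ (Fin (n + 1))} :
    w ∈ (vectorSpan ℝ (maxFace (AssIII n a) u))ᗮ ↔ ∀ i j, i ≤ j →
      ∀ k ∈ argmaxOn u (Set.Icc i j), ∀ l ∈ argmaxOn u (Set.Icc i j), w k = w l := by
  rw [AssIII_eq_simplexSum, mem_orthogonal_vectorSpan_maxFace_simplexSum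
    (fun t ht => ha _ _ (by simpa using ht))
    (fun t ht => Set.nonempty_Icc.2 (by simpa using ht)) ⟨0⟩]
  simp [Sigma.forall]

lemma mem_orthogonal_vectorSpan_AssIII (ha : ∀ i j, i ≤ j → 0 < a i j)
    {w : EuclideanSpace ℝ (Fin (n + 1))} :
    w ∈ (vectorSpan ℝ (AssIII n a))ᗮ ↔ ∀ k l, w k = w l := by
  rw [← maxFace_zero (AssIII n a), mem_orthogonal_vectorSpan_maxFace_AssIII ha]
  constructor
  · intro h k l
    exact h 0 (Fin.last n) (Fin.zero_le _) k ⟨⟨Fin.zero_le _, Fin.le_last _⟩, by simp⟩ l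
      ⟨⟨Fin.zero_le _, Fin.le_last _⟩, by simp⟩
  · exact fun h i j _ k _ l _ => h k l

/-- The all-ones vector. -/
noncomputable def onesVec (n : ℕ) : EuclideanSpace ℝ (Fin (n + 1)) := WithLp.toLp 2 fun _ => 1

@[simp] lemma onesVec_apply (k : Fin (n + 1)) : onesVec n k = 1 := rfl

open Classical in
/-- The negative of the indicator vector of a set. -/
noncomputable def negInd (s : Set (Fin (n + 1))) : EuclideanSpace ℝ (Fin (n + 1)) :=
  WithLp.toLp 2 fun k => if k ∈ s then -1 else 0

lemma negInd_of_mem {s : Set (Fin (n + 1))} {k : Fin (n + 1)} (h : k ∈ s) : negInd s k = -1 := by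
  simp [negInd, h]

lemma negInd_of_notMem {s : Set (Fin (n + 1))} {k : Fin (n + 1)} (h : k ∉ s) :
    negInd s k = 0 := by
  simp [negInd, h]

lemma negInd_eq_iff {s : Set (Fin (n + 1))} {k l : Fin (n + 1)} :
    negInd s k = negInd s l ↔ (k ∈ s ↔ l ∈ s) := by
  by_cases hk : k ∈ s <;> by_cases hl : l ∈ s <;> simp [negInd, hk, hl]

lemma mem_argmaxOn_negInd {s A : Set (Fin (n + 1))} {k : Fin (n + 1)} :
    k ∈ argmaxOn (negInd s) A ↔ k ∈ A ∧ (k ∈ s → A ⊆ s) := by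
  refine and_congr_right fun _ => ?_
  by_cases hk : k ∈ s
  · rw [negInd_of_mem hk]
    simp only [hk, forall_const]
    refine forall₂_congr fun l hl => ?_
    by_cases hls : l ∈ s
    · simp [negInd_of_mem hls, hls]
    · simp [negInd_of_notMem hls, hls]
  · rw [negInd_of_notMem hk]
    simp only [hk, false_imp_iff, iff_true]
    intro l _
    by_cases hls : l ∈ s
    · simp [negInd_of_mem hls]
    · simp [negInd_of_notMem hls]

lemma finrank_span_onesVec_pair {u : EuclideanSpace ℝ (Fin (n + 1))} {k l : Fin (n + 1)}
    (hu : u k ≠ u l) : Module.finrank ℝ (Submodule.span ℝ {onesVec n, u}) = 2 := by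
  have hli : LinearIndependent ℝ ![onesVec n, u] := by
    rw [LinearIndependent.pair_iff]
    intro s t hst
    have h : ∀ m, s + t * u m = 0 := fun m => by
      have := congrArg (fun v : EuclideanSpace ℝ (Fin (n + 1)) => v m) hst
      simpa using this
    have ht : t * (u k - u l) = 0 := by linarith [h k, h l]
    have ht0 : t = 0 := (mul_eq_zero.1 ht).resolve_right (sub_ne_zero.2 hu)
    have := h k
    rw [ht0] at this
    exact ⟨by simpa using this, ht0⟩
  have := finrank_span_eq_card hli
  rwa [Matrix.range_cons, Matrix.range_cons, Matrix.range_empty, Set.union_empty,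
    Set.singleton_union, Fintype.card_fin] at this

lemma onesVec_mem_orthogonal (ha : ∀ i j, i ≤ j → 0 < a i j) (u : EuclideanSpace ℝ (Fin (n + 1))) :
    onesVec n ∈ (vectorSpan ℝ (maxFace (AssIII n a) u))ᗮ :=
  (mem_orthogonal_vectorSpan_maxFace_AssIII ha).2 fun _ _ _ _ _ _ _ => rfl

/-- The polytope has codimension one, so its facets are the faces on which a two-dimensional space
of functionals is constant. -/
lemma finrank_orthogonal_vectorSpan_AssIII (ha : ∀ i j, i ≤ j → 0 < a i j) :
    Module.finrank ℝ (vectorSpan ℝ (AssIII n a))ᗮ = 1 := by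
  have h : (vectorSpan ℝ (AssIII n a))ᗮ = Submodule.span ℝ {onesVec n} := by
    ext w
    rw [mem_orthogonal_vectorSpan_AssIII ha, Submodule.mem_span_singleton]
    constructor
    · intro h
      refine ⟨w 0, ?_⟩
      ext k
      simp [h k 0]
    · rintro ⟨c, rfl⟩ k l
      simp
  rw [h, finrank_span_singleton]
  intro h0
  have := congrArg (fun v : EuclideanSpace ℝ (Fin (n + 1)) => v 0) h0
  simp at this

lemma isFacet_AssIII_iff_finrank (ha : ∀ i j, i ≤ j → 0 < a i j)
    {F : Set (EuclideanSpace ℝ (Fin (n + 1)))} :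
    IsFacet (AssIII n a) F ↔ ∃ u, F = maxFace (AssIII n a) u ∧
      Module.finrank ℝ (vectorSpan ℝ (maxFace (AssIII n a) u))ᗮ = 2 := by
  rw [isFacet_iff_finrank_orthogonal, finrank_orthogonal_vectorSpan_AssIII ha]
  constructor
  · rintro ⟨⟨-, u, rfl⟩, h⟩
    exact ⟨u, rfl, h⟩
  · rintro ⟨u, rfl, h⟩
    exact ⟨⟨maxFace_AssIII_nonempty ha u, u, rfl⟩, h⟩

/-- The linear functions that are constant on the face of a proper interval. -/
lemma mem_orthogonal_vectorSpan_maxFace_negInd_Icc (ha : ∀ i j, i ≤ j → 0 < a i j)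
    {p q : Fin (n + 1)} (hpq : p ≤ q)
    {w : EuclideanSpace ℝ (Fin (n + 1))} :
    w ∈ (vectorSpan ℝ (maxFace (AssIII n a) (negInd (Set.Icc p q))))ᗮ ↔
      ∀ k l, (k ∈ Set.Icc p q ↔ l ∈ Set.Icc p q) → w k = w l := by
  rw [mem_orthogonal_vectorSpan_maxFace_AssIII ha]
  constructor
  · intro h k l hkl
    by_cases hk : k ∈ Set.Icc p q
    · have hl := hkl.1 hk
      exact h p q hpq k (mem_argmaxOn_negInd.2 ⟨hk, fun _ => subset_rfl⟩) l
        (mem_argmaxOn_negInd.2 ⟨hl, fun _ => subset_rfl⟩)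
    · have hl := mt hkl.2 hk
      exact h 0 (Fin.last n) (Fin.zero_le _) k
        (mem_argmaxOn_negInd.2 ⟨⟨Fin.zero_le _, Fin.le_last _⟩, fun h => absurd h hk⟩) l
        (mem_argmaxOn_negInd.2 ⟨⟨Fin.zero_le _, Fin.le_last _⟩, fun h => absurd h hl⟩)
  · intro h i j _ k hk l hl
    obtain ⟨hkA, hk⟩ := mem_argmaxOn_negInd.1 hk
    obtain ⟨hlA, hl⟩ := mem_argmaxOn_negInd.1 hl
    exact h k l ⟨fun hks => hk hks hlA, fun hls => hl hls hkA⟩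

lemma isFacet_maxFace_negInd_Icc (ha : ∀ i j, i ≤ j → 0 < a i j)
    {p q : Fin (n + 1)} (hpq : p ≤ q) (hne : Set.Icc p q ≠ Set.univ) :
    IsFacet (AssIII n a) (maxFace (AssIII n a) (negInd (Set.Icc p q))) := by
  rw [isFacet_AssIII_iff_finrank ha]
  refine ⟨_, rfl, ?_⟩
  obtain ⟨r, hr⟩ := (Set.ne_univ_iff_exists_notMem _).1 hne
  have hp : p ∈ Set.Icc p q := Set.left_mem_Icc.2 hpq
  have hspan : (vectorSpan ℝ (maxFace (AssIII n a) (negInd (Set.Icc p q))))ᗮ =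
      Submodule.span ℝ {onesVec n, negInd (Set.Icc p q)} := by
    apply le_antisymm
    · intro w hw
      rw [mem_orthogonal_vectorSpan_maxFace_negInd_Icc ha hpq] at hw
      rw [Submodule.mem_span_pair]
      refine ⟨w r, w r - w p, ?_⟩
      ext k
      by_cases hk : k ∈ Set.Icc p q
      · simp [negInd_of_mem hk, hw k p (by simp only [hk, hp])]
      · simp [negInd_of_notMem hk, hw k r (by simp only [hk, hr])]
    · rw [Submodule.span_le]
      rintro v (rfl | rfl)
      · exact onesVec_mem_orthogonal ha _
      · exact mem_orthogonal_vectorSpan_maxFace _ _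
  rw [hspan]
  exact finrank_span_onesVec_pair (k := r) (l := p)
    (by rw [negInd_of_notMem hr, negInd_of_mem hp]; norm_num)

lemma exists_Icc_of_isFacet_AssIII (ha : ∀ i j, i ≤ j → 0 < a i j)
    {F : Set (EuclideanSpace ℝ (Fin (n + 1)))} (hF : IsFacet (AssIII n a) F) :
    ∃ p q : Fin (n + 1), p ≤ q ∧ Set.Icc p q ≠ Set.univ ∧
      F = maxFace (AssIII n a) (negInd (Set.Icc p q)) := by
  obtain ⟨u, rfl, hrank⟩ := (isFacet_AssIII_iff_finrank ha).1 hF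
  have hnc : ∃ k l, u k ≠ u l := by
    by_contra! hc
    have hmem : u ∈ (vectorSpan ℝ (AssIII n a))ᗮ := (mem_orthogonal_vectorSpan_AssIII ha).2 hc
    have := maxFace_add_of_mem_orthogonal hmem 0
    rw [add_zero, maxFace_zero] at this
    rw [this, finrank_orthogonal_vectorSpan_AssIII ha] at hrank
    omega
  obtain ⟨k₁, k₂, hk⟩ := hnc
  have hspan : Submodule.span ℝ {onesVec n, u} =
      (vectorSpan ℝ (maxFace (AssIII n a) u))ᗮ := by
    refine Submodule.eq_of_le_of_finrank_eq ?_ ?_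
    · rw [Submodule.span_le]
      rintro v (rfl | rfl)
      · exact onesVec_mem_orthogonal ha _
      · exact mem_orthogonal_vectorSpan_maxFace _ _
    · rw [hrank, finrank_span_onesVec_pair hk]
  -- For a facet, any `w` constant on all argmax sets of `u` is an affine function of `u`. Two test
  -- vectors `w` now determine the shape of `u`.
  have hlin : ∀ w : EuclideanSpace ℝ (Fin (n + 1)), (∀ i j, i ≤ j →
      ∀ k ∈ argmaxOn u (Set.Icc i j), ∀ l ∈ argmaxOn u (Set.Icc i j), w k = w l) →
      ∃ b c : ℝ, ∀ k, w k = b + c * u k := by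
    intro w hw
    rw [← mem_orthogonal_vectorSpan_maxFace_AssIII ha, ← hspan, Submodule.mem_span_pair] at hw
    obtain ⟨b, c, rfl⟩ := hw
    exact ⟨b, c, fun k => by simp⟩
  obtain ⟨m, hm⟩ := Finite.exists_max (fun k => u k)
  have hmax : ∀ i j k l, k ∈ argmaxOn u (Set.Icc i j) → l ∈ argmaxOn u (Set.Icc i j) →
      u k = u l := fun i j k l hk hl => le_antisymm (hl.2 k hk.1) (hk.2 l hl.1)
  obtain ⟨s, hs⟩ : ∃ s : Set (Fin (n + 1)), ∀ k, k ∈ s ↔ u k < u m := ⟨{k | u k < u m}, fun _ => Iff.rfl⟩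
  have hms : m ∉ s := fun h => lt_irrefl _ ((hs m).1 h)
  have hsne : s.Nonempty := by
    by_contra hemp
    have h : ∀ k, u k = u m := fun k => le_antisymm (hm k) (not_lt.1 fun hlt =>
      hemp ⟨k, (hs k).2 hlt⟩)
    exact hk (by rw [h k₁, h k₂])
  -- First test: the indicator of where `u` is not maximal. It shows that `u` takes only two values.
  obtain ⟨b, c, hbc⟩ := hlin (negInd s) (by
    intro i j _ k hk l hl
    rw [negInd_eq_iff, hs, hs, hmax i j k l hk hl])
  have hbc' : ∀ k, negInd s k = c * (u k - u m) := fun k => by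
    have h1 := hbc m
    rw [negInd_of_notMem hms] at h1
    rw [hbc k]
    linarith
  have hc : 0 < c := by
    obtain ⟨k, hks⟩ := hsne
    have h1 := hbc' k
    rw [negInd_of_mem hks] at h1
    have h2 := (hs k).1 hks
    by_contra hc
    nlinarith [mul_nonneg_of_nonpos_of_nonpos (not_lt.1 hc) (sub_nonpos.2 h2.le)]
  have hface : maxFace (AssIII n a) u = maxFace (AssIII n a) (negInd s) := by
    have hu : u = u m • onesVec n + c⁻¹ • negInd s := by
      ext k
      simp only [PiLp.add_apply, PiLp.smul_apply, onesVec_apply, smul_eq_mul, mul_one, hbc' k]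
      rw [← mul_assoc, inv_mul_cancel₀ hc.ne']
      ring
    have hone : u m • onesVec n ∈ (vectorSpan ℝ (AssIII n a))ᗮ :=
      (mem_orthogonal_vectorSpan_AssIII ha).2 fun k l => by simp
    conv_lhs => rw [hu]
    rw [maxFace_add_of_mem_orthogonal hone, maxFace_smul _ _ (inv_pos.2 hc)]
  have hconv : ∀ k ∈ s, ∀ l ∈ s, ∀ r, k ≤ r → r ≤ l → r ∈ s := by
    intro k hks l hls r hkr hrl
    by_contra hr
    -- Second test: if `r` were a hole in `s`, cut `s` at `r`. An argmax set inside `s` comes from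
    -- an interval avoiding `r`, so it stays on one side; yet the cut separates `k` from `l`, where
    -- `u` agrees.
    obtain ⟨b', c', hbc''⟩ := hlin (negInd {x | x ∈ s ∧ x < r}) (by
      intro i j _ k' hk' l' hl'
      have heq := hmax i j k' l' hk' hl'
      have hiff : k' ∈ s ↔ l' ∈ s := by rw [hs, hs, heq]
      rw [negInd_eq_iff, Set.mem_ofPred_eq, Set.mem_ofPred_eq, hiff]
      refine and_congr_right fun hl's => ?_
      have hrA : r ∉ Set.Icc i j := fun hrA => hr ((hs r).2
        ((hl'.2 r hrA).trans_lt ((hs l').1 hl's)))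
      constructor
      · intro h
        by_contra h'
        exact hrA ⟨hk'.1.1.trans h.le, (not_lt.1 h').trans hl'.1.2⟩
      · intro h
        by_contra h'
        exact hrA ⟨hl'.1.1.trans h.le, (not_lt.1 h').trans hk'.1.2⟩)
    have hukl : u k = u l := by
      have h1 := hbc' k
      have h2 := hbc' l
      rw [negInd_of_mem hks] at h1
      rw [negInd_of_mem hls, h1] at h2
      have := mul_left_cancel₀ hc.ne' h2
      linarith
    have hkr' : k < r := lt_of_le_of_ne hkr fun h => hr (h ▸ hks)
    have h1 := hbc'' k
    have h2 := hbc'' l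
    rw [negInd_of_mem (show k ∈ {x | x ∈ s ∧ x < r} from ⟨hks, hkr'⟩)] at h1
    rw [negInd_of_notMem (show l ∉ {x | x ∈ s ∧ x < r} from fun h => h.2.not_ge hrl), ← hukl,
      ← h1] at h2
    norm_num at h2
  obtain ⟨p, hps, hp⟩ := Set.exists_min_image s id s.toFinite hsne
  obtain ⟨q, hqs, hq⟩ := Set.exists_max_image s id s.toFinite hsne
  have hsIcc : s = Set.Icc p q :=
    Set.Subset.antisymm (fun k hk => ⟨hp k hk, hq k hk⟩)
      fun k hk => hconv p hps q hqs k hk.1 hk.2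
  refine ⟨p, q, hp q hqs, ?_, by rw [hface, hsIcc]⟩
  rw [← hsIcc]
  exact (Set.ne_univ_iff_exists_notMem _).2 ⟨m, hms⟩

/-- The initial segment `[0, k]` or the final segment `[k + 1, n]`. -/
def endInterval : Fin n × Bool → Set (Fin (n + 1))
  | (k, true) => Set.Icc 0 k.castSucc
  | (k, false) => Set.Icc k.succ (Fin.last n)

lemma mem_endInterval_true {k : Fin n} {r : Fin (n + 1)} : r ∈ endInterval (k, true) ↔ (r : ℕ) ≤ k := by
  simp [endInterval, Fin.le_def]

lemma mem_endInterval_false {k : Fin n} {r : Fin (n + 1)} :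
    r ∈ endInterval (k, false) ↔ (k : ℕ) < r := by
  have := r.is_le
  simp only [endInterval, Set.mem_Icc, Fin.le_def, Fin.val_succ, Fin.val_last]
  omega

lemma compl_endInterval (k : Fin n) (b : Bool) : (endInterval (k, b))ᶜ = endInterval (k, !b) := by
  ext r
  cases b
  · simp [mem_endInterval_true, mem_endInterval_false]
  · simp [mem_endInterval_true, mem_endInterval_false]

lemma endInterval_ne_univ (p : Fin n × Bool) : endInterval p ≠ Set.univ := by
  rw [Set.ne_univ_iff_exists_notMem]
  obtain ⟨k, _ | _⟩ := p
  · exact ⟨0, by simp [mem_endInterval_false]⟩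
  · exact ⟨Fin.last n, by simp [mem_endInterval_true]⟩

lemma exists_endInterval_eq_Icc (p : Fin n × Bool) :
    ∃ i j : Fin (n + 1), i ≤ j ∧ endInterval p = Set.Icc i j := by
  obtain ⟨k, _ | _⟩ := p
  · exact ⟨_, _, Fin.le_last _, rfl⟩
  · exact ⟨_, _, Fin.zero_le _, rfl⟩

lemma endInterval_injective : Function.Injective (endInterval (n := n)) := by
  rintro ⟨k, _ | _⟩ ⟨l, _ | _⟩ h
  · have h1 := Set.ext_iff.1 h k.succ
    have h2 := Set.ext_iff.1 h l.succ
    simp only [mem_endInterval_false, Fin.val_succ] at h1 h2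
    rw [show k = l from Fin.ext (by omega)]
  · have h1 := Set.ext_iff.1 h 0
    simp [mem_endInterval_false, mem_endInterval_true] at h1
  · have h1 := Set.ext_iff.1 h 0
    simp [mem_endInterval_false, mem_endInterval_true] at h1
  · have h1 := Set.ext_iff.1 h k.castSucc
    have h2 := Set.ext_iff.1 h l.castSucc
    simp only [mem_endInterval_true, Fin.val_castSucc] at h1 h2
    rw [show k = l from Fin.ext (by omega)]

/-- An interval whose complement is an interval is an initial or a final segment. -/
lemma exists_eq_endInterval {p q p' q' : Fin (n + 1)} (hpq : p ≤ q) (hne : Set.Icc p q ≠ Set.univ)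
    (h : Set.Icc p' q' = (Set.Icc p q)ᶜ) : ∃ t, Set.Icc p q = endInterval t := by
  have hmem : ∀ r : Fin (n + 1), (p' ≤ r ∧ r ≤ q') ↔ ¬ (p ≤ r ∧ r ≤ q) := fun r =>
    Set.ext_iff.1 h r
  obtain ⟨r, hr⟩ := (Set.ne_univ_iff_exists_notMem _).1 hne
  have hr : ¬ (p ≤ r ∧ r ≤ q) := hr
  have h0 := hmem 0
  have hl := hmem (Fin.last n)
  have hp := hmem p
  have hr' := hmem r
  have := q.isLt
  have := r.isLt
  simp only [Fin.le_def, Fin.val_zero, Fin.val_last] at h0 hl hp hr' hpq hr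
  rcases Nat.eq_zero_or_pos p with hp0 | hp0
  · refine ⟨(⟨q, by omega⟩, true), ?_⟩
    ext x
    rw [mem_endInterval_true, Set.mem_Icc, Fin.le_def, Fin.le_def]
    simp only
    omega
  · refine ⟨(⟨p - 1, by omega⟩, false), ?_⟩
    ext x
    have := x.isLt
    rw [mem_endInterval_false, Set.mem_Icc, Fin.le_def, Fin.le_def]
    simp only
    omega

/-- Parallel faces belong to equal or complementary intervals. -/
lemma eq_or_eq_compl_of_negInd_mem_orthogonal (ha : ∀ i j, i ≤ j → 0 < a i j)
    {p q : Fin (n + 1)} (hpq : p ≤ q) {s : Set (Fin (n + 1))} (hs : s.Nonempty)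
    (hs' : s ≠ Set.univ)
    (h : negInd s ∈ (vectorSpan ℝ (maxFace (AssIII n a) (negInd (Set.Icc p q))))ᗮ) :
    s = Set.Icc p q ∨ s = (Set.Icc p q)ᶜ := by
  rw [mem_orthogonal_vectorSpan_maxFace_negInd_Icc ha hpq] at h
  simp only [negInd_eq_iff] at h
  obtain ⟨k, hk⟩ := hs
  obtain ⟨l, hl⟩ := (Set.ne_univ_iff_exists_notMem _).1 hs'
  by_cases hkI : k ∈ Set.Icc p q
  · left
    ext r
    have h1 := h r k
    have h2 := h r l
    have h3 := h k l
    tauto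
  · right
    ext r
    have h1 := h r k
    have h2 := h r l
    have h3 := h k l
    rw [Set.mem_compl_iff]
    tauto

/-- The special facet of an associahedron of the third type given by an initial or final segment. -/
noncomputable def specialFacetIII (n : ℕ) (a : Fin (n + 1) → Fin (n + 1) → ℝ) (t : Fin n × Bool) :
    Set (EuclideanSpace ℝ (Fin (n + 1))) :=
  maxFace (AssIII n a) (negInd (endInterval t))

lemma specialFacetIII_inter_nonempty_iff (ha : ∀ i j, i ≤ j → 0 < a i j) {s t : Fin n × Bool} :
    (specialFacetIII n a s ∩ specialFacetIII n a t).Nonempty ↔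
      ∀ i j, i ≤ j → ∃ k ∈ Set.Icc i j, (k ∈ endInterval s → Set.Icc i j ⊆ endInterval s) ∧
        (k ∈ endInterval t → Set.Icc i j ⊆ endInterval t) := by
  rw [specialFacetIII, specialFacetIII, maxFace_AssIII_inter_nonempty_iff ha]
  refine forall₃_congr fun i j hij => exists_congr fun k => ?_
  rw [Set.mem_inter_iff, mem_argmaxOn_negInd, mem_argmaxOn_negInd]
  tauto

/-- The right end of any interval is a common maximizer: it lies in an initial segment only if the
whole interval does. Final segments use the left end. -/
lemma specialFacetIII_inter_nonempty_true_true (ha : ∀ i j, i ≤ j → 0 < a i j) (k l : Fin n) :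
    (specialFacetIII n a (k, true) ∩ specialFacetIII n a (l, true)).Nonempty := by
  rw [specialFacetIII_inter_nonempty_iff ha]
  refine fun i j hij => ⟨j, ⟨hij, le_rfl⟩, fun h r hr => ?_, fun h r hr => ?_⟩
  all_goals
    rw [mem_endInterval_true] at h ⊢
    exact (Fin.le_def.1 hr.2).trans h

lemma specialFacetIII_inter_nonempty_false_false (ha : ∀ i j, i ≤ j → 0 < a i j) (k l : Fin n) :
    (specialFacetIII n a (k, false) ∩ specialFacetIII n a (l, false)).Nonempty := by
  rw [specialFacetIII_inter_nonempty_iff ha]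
  refine fun i j hij => ⟨i, ⟨le_rfl, hij⟩, fun h r hr => ?_, fun h r hr => ?_⟩
  all_goals
    rw [mem_endInterval_false] at h ⊢
    exact h.trans_le (Fin.le_def.1 hr.1)

lemma specialFacetIII_inter_nonempty_true_false (ha : ∀ i j, i ≤ j → 0 < a i j) (k l : Fin n) :
    (specialFacetIII n a (k, true) ∩ specialFacetIII n a (l, false)).Nonempty ↔ k < l := by
  rw [specialFacetIII_inter_nonempty_iff ha, Fin.lt_def]
  constructor
  · intro h
    -- The full interval fits in neither segment, so its common maximizer must lie in the gap
    -- between them.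
    obtain ⟨r, -, h1, h2⟩ := h 0 (Fin.last n) (Fin.zero_le _)
    have hk : ¬ (r : ℕ) ≤ k := fun hr => by
      have := mem_endInterval_true.1 (h1 (mem_endInterval_true.2 hr)
        (Set.right_mem_Icc.2 (Fin.zero_le (Fin.last n))))
      rw [Fin.val_last] at this
      exact absurd k.isLt this.not_gt
    have hl : ¬ (l : ℕ) < r := fun hr => by
      have := mem_endInterval_false.1 (h2 (mem_endInterval_false.2 hr)
        (Set.left_mem_Icc.2 (Fin.zero_le (Fin.last n))))
      simp at this
    omega
  · intro hkl i j hij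
    have hij' := Fin.le_def.1 hij
    simp only [Set.subset_def, mem_endInterval_true, mem_endInterval_false, Set.mem_Icc, Fin.le_def]
    by_cases hj : (j : ℕ) ≤ l
    · exact ⟨j, ⟨hij', le_rfl⟩, fun h r hr => hr.2.trans h, fun h => by omega⟩
    · by_cases hi : (k : ℕ) < i
      · exact ⟨i, ⟨le_rfl, hij'⟩, fun h => by omega, fun h r hr => h.trans_le hr.1⟩
      -- Now `i ≤ k` and `l < j`, so the interval contains the gap, whose first element is `k + 1`.
      · exact ⟨k.succ, ⟨by simp only [Fin.val_succ]; omega, by simp only [Fin.val_succ]; omega⟩,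
          fun h => by simp only [Fin.val_succ] at h; omega,
          fun h => by simp only [Fin.val_succ] at h; omega⟩

lemma endInterval_nonempty (t : Fin n × Bool) : (endInterval t).Nonempty := by
  obtain ⟨i, j, hij, h⟩ := exists_endInterval_eq_Icc t
  rw [h]
  exact Set.nonempty_Icc.2 hij

/-- Equal faces force equal or complementary segments. Complementary ones leave the full interval
without a common maximizer, so their faces are disjoint. -/
lemma specialFacetIII_injective (ha : ∀ i j, i ≤ j → 0 < a i j) :
    Function.Injective (specialFacetIII n a) := by
  intro s t hst
  obtain ⟨p, q, hpq, hp⟩ := exists_endInterval_eq_Icc s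
  have hmem := mem_orthogonal_vectorSpan_maxFace (AssIII n a) (negInd (endInterval t))
  change negInd (endInterval t) ∈ (vectorSpan ℝ (specialFacetIII n a t))ᗮ at hmem
  rw [← hst, specialFacetIII, hp] at hmem
  rcases eq_or_eq_compl_of_negInd_mem_orthogonal ha hpq (endInterval_nonempty t) (endInterval_ne_univ t)
    hmem with h | h
  · exact endInterval_injective (hp.trans h.symm)
  · exfalso
    rw [← hp] at h
    have hne : (specialFacetIII n a s ∩ specialFacetIII n a t).Nonempty := by
      rw [hst, Set.inter_self]
      exact maxFace_AssIII_nonempty ha _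
    obtain ⟨r, -, h1, h2⟩ := (specialFacetIII_inter_nonempty_iff ha).1 hne 0 (Fin.last n)
      (Fin.zero_le _)
    have huniv : Set.Icc 0 (Fin.last n) = Set.univ :=
      Set.eq_univ_of_forall fun x => ⟨Fin.zero_le _, Fin.le_last _⟩
    rw [huniv, Set.univ_subset_iff] at h1 h2
    by_cases hr : r ∈ endInterval s
    · exact endInterval_ne_univ s (h1 hr)
    · exact endInterval_ne_univ t (h2 (by rw [h]; exact hr))

lemma specialFacets_AssIII_eq (ha : ∀ i j, i ≤ j → 0 < a i j) :
    specialFacets (AssIII n a) = Set.range (specialFacetIII n a) := by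
  ext F
  constructor
  · rintro ⟨hF, F', hF', hne, hpar⟩
    obtain ⟨p, q, hpq, hI, rfl⟩ := exists_Icc_of_isFacet_AssIII ha hF
    obtain ⟨p', q', hpq', hI', rfl⟩ := exists_Icc_of_isFacet_AssIII ha hF'
    rw [parallel_iff_orthogonal_eq (maxFace_AssIII_nonempty ha _)
      (maxFace_AssIII_nonempty ha _)] at hpar
    have hmem := mem_orthogonal_vectorSpan_maxFace (AssIII n a) (negInd (Set.Icc p' q'))
    rw [← hpar] at hmem
    rcases eq_or_eq_compl_of_negInd_mem_orthogonal ha hpq (Set.nonempty_Icc.2 hpq') hI' hmem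
      with h | h
    · exact absurd (by rw [h]) hne
    · obtain ⟨t, ht⟩ := exists_eq_endInterval hpq hI h
      exact ⟨t, by rw [specialFacetIII, ht]⟩
  · have hfacet : ∀ t, IsFacet (AssIII n a) (specialFacetIII n a t) := by
      intro t
      obtain ⟨p, q, hpq, hp⟩ := exists_endInterval_eq_Icc t
      rw [specialFacetIII, hp]
      exact isFacet_maxFace_negInd_Icc ha hpq (hp ▸ endInterval_ne_univ t)
    rintro ⟨⟨k, b⟩, rfl⟩
    refine ⟨hfacet _, _, hfacet (k, !b), (specialFacetIII_injective ha).ne (by simp), ?_⟩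
    rw [specialFacetIII, specialFacetIII, parallel_iff_orthogonal_eq (maxFace_AssIII_nonempty ha _)
      (maxFace_AssIII_nonempty ha _)]
    obtain ⟨p, q, hpq, hp⟩ := exists_endInterval_eq_Icc (k, b)
    obtain ⟨p', q', hpq', hp'⟩ := exists_endInterval_eq_Icc (k, !b)
    ext w
    rw [hp, hp', mem_orthogonal_vectorSpan_maxFace_negInd_Icc ha hpq,
      mem_orthogonal_vectorSpan_maxFace_negInd_Icc ha hpq', ← hp, ← hp', ← compl_endInterval]
    -- Being constant on a set and on its complement is a condition symmetric in the two, which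
    -- gives parallelism.
    simp only [Set.mem_compl_iff, not_iff_not]

lemma ncard_specialNeighbors_specialFacetIII_true (ha : ∀ i j, i ≤ j → 0 < a i j) (k : Fin n) :
    (specialNeighbors (AssIII n a) (specialFacetIII n a (k, true))).ncard =
      (n - 1) + {l : Fin n | k < l}.ncard := by
  rw [ncard_specialNeighbors (specialFacetIII_injective ha) (specialFacets_AssIII_eq ha),
    ncard_set_prod_bool]
  congr 1
  · rw [← ncard_ne k]
    congr 1
    ext l
    simp [specialFacetIII_inter_nonempty_true_true ha]
  · congr 1
    ext l
    simp [specialFacetIII_inter_nonempty_true_false ha]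

lemma ncard_specialNeighbors_specialFacetIII_false (ha : ∀ i j, i ≤ j → 0 < a i j) (k : Fin n) :
    (specialNeighbors (AssIII n a) (specialFacetIII n a (k, false))).ncard =
      {l : Fin n | l < k}.ncard + (n - 1) := by
  rw [ncard_specialNeighbors (specialFacetIII_injective ha) (specialFacets_AssIII_eq ha),
    ncard_set_prod_bool]
  congr 1
  · congr 1
    ext l
    rw [Set.mem_ofPred_eq, Set.mem_ofPred_eq, Set.inter_comm,
      specialFacetIII_inter_nonempty_true_false ha]
    simp
  · rw [← ncard_ne k]
    congr 1
    ext l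
    simp [specialFacetIII_inter_nonempty_false_false ha]

lemma ncard_specialFacets_AssIII_with (hn : 0 < n) (ha : ∀ i j, i ≤ j → 0 < a i j) :
    {F ∈ specialFacets (AssIII n a) |
      (specialNeighbors (AssIII n a) F).ncard = n - 1}.ncard = 2 := by
  have h : {F ∈ specialFacets (AssIII n a) |
      (specialNeighbors (AssIII n a) F).ncard = n - 1} =
      {specialFacetIII n a (⟨n - 1, by omega⟩, true), specialFacetIII n a (⟨0, hn⟩, false)} := by
    rw [specialFacets_AssIII_eq ha]
    ext F
    simp only [Set.mem_ofPred_eq, Set.mem_insert_iff, Set.mem_singleton_iff]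
    constructor
    · rintro ⟨⟨⟨k, _ | _⟩, rfl⟩, hcard⟩
      · right
        rw [ncard_specialNeighbors_specialFacetIII_false ha, Nat.add_eq_right,
          Set.ncard_eq_zero (Set.toFinite _), Set.eq_empty_iff_forall_notMem] at hcard
        have := hcard ⟨0, hn⟩
        simp only [Set.mem_ofPred_eq, Fin.lt_def] at this
        rw [show k = ⟨0, hn⟩ from Fin.ext (by simp only; omega)]
      · left
        rw [ncard_specialNeighbors_specialFacetIII_true ha, Nat.add_eq_left,
          Set.ncard_eq_zero (Set.toFinite _), Set.eq_empty_iff_forall_notMem] at hcard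
        have := hcard ⟨n - 1, by omega⟩
        simp only [Set.mem_ofPred_eq, Fin.lt_def] at this
        have := k.isLt
        rw [show k = ⟨n - 1, by omega⟩ from Fin.ext (by simp only; omega)]
    · rintro (rfl | rfl)
      · refine ⟨⟨_, rfl⟩, ?_⟩
        rw [ncard_specialNeighbors_specialFacetIII_true ha, Nat.add_eq_left,
          Set.ncard_eq_zero (Set.toFinite _), Set.eq_empty_iff_forall_notMem]
        intro l
        have := l.isLt
        simp only [Set.mem_ofPred_eq, Fin.lt_def]
        omega
      · refine ⟨⟨_, rfl⟩, ?_⟩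
        rw [ncard_specialNeighbors_specialFacetIII_false ha, Nat.add_eq_right,
          Set.ncard_eq_zero (Set.toFinite _), Set.eq_empty_iff_forall_notMem]
        intro l
        simp [Fin.lt_def]
  rw [h, Set.ncard_pair]
  exact (specialFacetIII_injective ha).ne (by simp)

end AssIII

theorem theorem5 (n : ℕ) (hn : 3 ≤ n)
    (P : Set (sumZero n)) (hP : IsAssII n P)
    (a : Fin (n + 1) → Fin (n + 1) → ℝ) (ha : ∀ i j, i ≤ j → 0 < a i j) :
    ¬ AffinelyEquivalent P (AssIII n a) ∧
    (specialFacets P).ncard = 2 * n ∧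
    (specialFacets (AssIII n a)).ncard = 2 * n ∧
    {F ∈ specialFacets (AssIII n a) |
      (specialNeighbors (AssIII n a) F).ncard = n - 1}.ncard = 2 ∧
    (3 < n → ∀ F ∈ specialFacets P, n - 1 < (specialNeighbors P F).ncard) ∧
    (n = 3 → ∃! F, F ∈ specialFacets P ∧ (specialNeighbors P F).ncard = n - 1) := by
  have hcard : Nat.card (Fin n × Bool) = 2 * n := by simp [Nat.card_eq_fintype_card, mul_comm]
  refine ⟨?_, ?_, ?_, ncard_specialFacets_AssIII_with (by omega) ha,
    fun hn' F hF => hP.lt_ncard_specialNeighbors hn' hF, ?_⟩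
  · rintro ⟨f, hf⟩
    have hconv : Convex ℝ P := by
      obtain ⟨s, -, rfl⟩ := hP.1
      exact convex_convexHull ℝ s
    have hinj : Function.Injective f := injective_of_injOn_of_vectorSpan_eq_top hf.injOn hconv
      hP.hasSimplicialNormalFan.vectorSpan_eq_top hP.hasSimplicialNormalFan.nonempty
    have h := ncard_specialFacets_with_ncard_specialNeighbors_image hinj P (n - 1)
    rw [hf.image_eq, ncard_specialFacets_AssIII_with (by omega) ha] at h
    have := hP.ncard_specialFacets_with_le_one hn
    omega
  · rw [ncard_specialFacets hP.specialFacetII_injective hP.specialFacets_eq, hcard]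
  · rw [ncard_specialFacets (specialFacetIII_injective ha) (specialFacets_AssIII_eq ha), hcard]
  · rintro rfl
    exact hP.existsUnique_ncard_specialNeighbors_eq
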